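/- Let $(M,g)$ be a smooth $n$-dimensional Riemannian manifold, $n\ge 1$, with Riemannian volume $V_g$, and let $\Omega\subset M$ be a nonempty, open, connected, relatively compact subset whose boundary $\partial\Omega$ is Lipschitz if it is nonempty. Let $A=-\triangle_g$ be the Laplace-Beltrami operator on $\Omega$, with one of the following boundary conditions if $\partial\Omega\neq\emptyset$: Dirichlet; Neumann; mixed Dirichlet-Neumann (Dirichlet on $\Gamma_0$ and Neumann on $\Gamma_1$, where $\partial\Omega=\Gamma_0\cup\Gamma_1$ is a partition into measurable sets); or Robin, $\frac{\partial y}{\partial n}+\beta y=0$, where $\beta\ge 0$ is a bounded measurable function on $\partial\Omega$ with $\int_{\partial\Omega}\beta>0$. Let $X=L^2_0(\Omega,\mathbb{C})=\{y\in L^2(\Omega,\mathbb{C}) : \int_\Omega y\,dV_g=0\}$ if $\partial\Omega=\emptyset$ or in the Neumann case, and $X=L^2(\Omega,\mathbb{C})$ otherwise. Let $(\phi_j)_{j\in\mathbb{N}^*}$ be an orthonormal Hilbert basis of $X$ consisting of real-valued eigenfunctions of $A$, associated with positive eigenvalues $\lambda_j^2$. Assume: (i) (Quantum Unique Ergodicity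 on the base) the whole sequence of probability measures $\phi_j^2\,dV_g$ on $\Omega$ converges vaguely to the uniform measure $\frac{1}{V_g(\Omega)}\,dV_g$; (ii) (uniform $L^p$-boundedness) there exist $p\in(1,+\infty]$ and $A_0>0$ such that $\Vert\phi_j\Vert_{L^{2p}(\Omega)}\le A_0$ for every $j\in\mathbb{N}^*$. Then, for every $L\in(0,1)$, $$\sup_{\omega}\ \inf_{j\in\mathbb{N}^*}\int_\omega \phi_j(x)^2\,dV_g = L,$$ where the supremum is taken over all measurable subsets $\omega\subset\Omega$ such that $V_g(\omega)=L\,V_g(\Omega)$ and $V_g(\partial\omega)=0$ (the Jordan measurable subsets of $\Omega$ of measure $L\,V_g(\Omega)$). -/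

import Mathlib

open MeasureTheory Filter Topology Set Manifold Bundle
open scoped ENNReal NNReal ContDiff

noncomputable section

/-! ## The Riemannian volume -/

section Volume

variable (n : ℕ) {M : Type*} [EMetricSpace M] [ChartedSpace (EuclideanSpace ℝ (Fin n)) M]

/-- The tangent vector at the point with coordinates `y` in the preferred chart around `c` whose
coordinates in that chart are `v`; `coordVec n c y e_a` is the coordinate vector field `∂_a`. -/
def coordVec (c : M) (y v : EuclideanSpace ℝ (Fin n)) :
    TangentSpace (𝓡 n) ((chartAt (EuclideanSpace ℝ (Fin n)) c).symm y) :=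
  mfderiv 𝓘(ℝ, EuclideanSpace ℝ (Fin n)) (𝓡 n)
    (chartAt (EuclideanSpace ℝ (Fin n)) c).symm y v

variable [RiemannianBundle (fun x : M => TangentSpace (𝓡 n) x)]

/-- The matrix `g_{ab} = g(∂_a, ∂_b)` of the metric in the preferred chart around `c`, at the
point with coordinates `y`. -/
def metricMatrix (c : M) (y : EuclideanSpace ℝ (Fin n)) : Matrix (Fin n) (Fin n) ℝ :=
  Matrix.of fun a b =>
    inner ℝ (coordVec n c y (EuclideanSpace.single a 1)) (coordVec n c y (EuclideanSpace.single b 1))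

/-- A partition of unity subordinate to the domains of the preferred charts. -/
def chartPartition (M : Type*) [EMetricSpace M] [ChartedSpace (EuclideanSpace ℝ (Fin n)) M] :
    PartitionOfUnity M M univ :=
  Classical.choose (PartitionOfUnity.exists_isSubordinate (X := M) isClosed_univ
    (fun c : M => (chartAt (EuclideanSpace ℝ (Fin n)) c).source)
    (fun c => (chartAt (EuclideanSpace ℝ (Fin n)) c).open_source)
    (fun x _ => mem_iUnion.2 ⟨x, mem_chart_source _ x⟩))

lemma chartPartition_isSubordinate (M : Type*) [EMetricSpace M]
    [ChartedSpace (EuclideanSpace ℝ (Fin n)) M] :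
    (chartPartition n M).IsSubordinate
      (fun c : M => (chartAt (EuclideanSpace ℝ (Fin n)) c).source) :=
  Classical.choose_spec (PartitionOfUnity.exists_isSubordinate (X := M) isClosed_univ
    (fun c : M => (chartAt (EuclideanSpace ℝ (Fin n)) c).source)
    (fun c => (chartAt (EuclideanSpace ℝ (Fin n)) c).open_source)
    (fun x _ => mem_iUnion.2 ⟨x, mem_chart_source _ x⟩))

variable [MeasurableSpace M]

/-- The Riemannian volume on the domain of the preferred chart around `c`: the measure
`√(det g) dy` on the range of the chart, transported to `M`. -/
def chartVolume (c : M) : Measure M :=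
  (((volume : Measure (EuclideanSpace ℝ (Fin n))).restrict
      (chartAt (EuclideanSpace ℝ (Fin n)) c).target).withDensity
    (fun y => ENNReal.ofReal (Real.sqrt (metricMatrix n c y).det))).map
    (chartAt (EuclideanSpace ℝ (Fin n)) c).symm

/-- The Riemannian volume `V_g`: the measures `√(det g) dy` of the charts, glued by a partition of
unity (the result does not depend on the partition, by the change of variables formula). -/
def riemVol (M : Type*) [EMetricSpace M] [ChartedSpace (EuclideanSpace ℝ (Fin n)) M]
    [RiemannianBundle (fun x : M => TangentSpace (𝓡 n) x)] [MeasurableSpace M] : Measure M :=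
  Measure.sum fun c : M =>
    (chartVolume n c).withDensity (fun p => ENNReal.ofReal (chartPartition n M c p))

end Volume

/-! ## Lipschitz boundary -/

section Lipschitz

variable (n : ℕ) {M : Type*} [EMetricSpace M] [ChartedSpace (EuclideanSpace ℝ (Fin n)) M]

/-- `∂Ω` is Lipschitz: near each of its points, in a chart, `Ω` is the strict subgraph, in some
direction `ξ`, of a Lipschitz function `h` of the coordinates orthogonal to `ξ`. (This holds
trivially if `∂Ω` is empty.) -/
def HasLipschitzBoundary (Ω : Set M) : Prop :=
  ∀ x ∈ frontier Ω, ∃ ξ : EuclideanSpace ℝ (Fin n), ‖ξ‖ = 1 ∧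
    ∃ (K : ℝ≥0) (h : EuclideanSpace ℝ (Fin n) → ℝ), LipschitzWith K h ∧
      ∀ᶠ p in 𝓝 x,
        let y := chartAt (EuclideanSpace ℝ (Fin n)) x p
        (p ∈ Ω ↔ inner ℝ ξ y < h (y - inner ℝ ξ y • ξ))

end Lipschitz

/-! ## Sobolev spaces and traces -/

section Sobolev

variable (n : ℕ) {M : Type*} [EMetricSpace M] [ChartedSpace (EuclideanSpace ℝ (Fin n)) M]
  [RiemannianBundle (fun x : M => TangentSpace (𝓡 n) x)]

/-- The vector field `X` is the weak gradient of `u` on the open set `Ω`: in each chart the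
functions `y ↦ g(X, v)`, for constant `v`, are the weak derivatives of `u` in the direction `v`. -/
def IsWeakGradient (Ω : Set M) (u : M → ℝ) (X : ∀ p : M, TangentSpace (𝓡 n) p) : Prop :=
  ∀ c : M,
    let e := chartAt (EuclideanSpace ℝ (Fin n)) c
    let D : Set (EuclideanSpace ℝ (Fin n)) := e.target ∩ e.symm ⁻¹' Ω
    LocallyIntegrableOn (fun y => u (e.symm y)) D ∧
    ∀ v : EuclideanSpace ℝ (Fin n),
      LocallyIntegrableOn (fun y => (inner ℝ (X (e.symm y)) (coordVec n c y v) : ℝ)) D ∧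
      ∀ ψ : EuclideanSpace ℝ (Fin n) → ℝ, ContDiff ℝ ∞ ψ → HasCompactSupport ψ → tsupport ψ ⊆ D →
        ∫ y in D, u (e.symm y) * fderiv ℝ ψ y v
          = - ∫ y in D, (inner ℝ (X (e.symm y)) (coordVec n c y v) : ℝ) * ψ y

variable [MeasurableSpace M]

/-- `u` is in the Sobolev space `H¹(Ω)` and `X` is its weak gradient. -/
def MemH1 (Ω : Set M) (u : M → ℝ) (X : ∀ p : M, TangentSpace (𝓡 n) p) : Prop :=
  MemLp u 2 ((riemVol n M).restrict Ω) ∧ IsWeakGradient n Ω u X ∧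
    ∫⁻ p in Ω, ‖X p‖ₑ ^ 2 ∂(riemVol n M) < ⊤

/-- The square of the `H¹(Ω)` distance of `u` and `v`, with weak gradients `X` and `Y`. -/
def h1DistSq (Ω : Set M) (u : M → ℝ) (X : ∀ p : M, TangentSpace (𝓡 n) p)
    (v : M → ℝ) (Y : ∀ p : M, TangentSpace (𝓡 n) p) : ℝ≥0∞ :=
  ∫⁻ p in Ω, (‖u p - v p‖ₑ ^ 2 + ‖X p - Y p‖ₑ ^ 2) ∂(riemVol n M)

/-- `u` is in `H¹₀(Ω)`, the closure in `H¹(Ω)` of the smooth functions with compact support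
in `Ω`, and `X` is its weak gradient. -/
def MemH10 (Ω : Set M) (u : M → ℝ) (X : ∀ p : M, TangentSpace (𝓡 n) p) : Prop :=
  MemH1 n Ω u X ∧ ∃ (f : ℕ → M → ℝ) (Y : ℕ → ∀ p : M, TangentSpace (𝓡 n) p),
    (∀ k, ContMDiff (𝓡 n) 𝓘(ℝ, ℝ) ∞ (f k) ∧ HasCompactSupport (f k) ∧ tsupport (f k) ⊆ Ω ∧
      IsWeakGradient n Ω (f k) (Y k)) ∧
    Tendsto (fun k => h1DistSq n Ω u X (f k) (Y k)) atTop (𝓝 0)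

variable [BorelSpace M]

/-- The surface measure of `∂Ω`: the restriction to `∂Ω` of the `(n-1)`-dimensional Hausdorff
measure (of the Riemannian distance), normalized so as to agree with Lebesgue measure on
`(n-1)`-dimensional Euclidean spaces. -/
def surfaceMeasure (Ω : Set M) : Measure M :=
  (μHE[n - 1] : Measure M).restrict (frontier Ω)

/-- `τ` is the trace on `∂Ω` of the function `u` of `H¹(Ω)`, with weak gradient `X`: there are smooth
functions on `M` that converge to `u` in `H¹(Ω)` and whose restrictions to `∂Ω` converge to `τ`
in `L²(∂Ω)`. -/
def IsTrace (Ω : Set M) (u : M → ℝ) (X : ∀ p : M, TangentSpace (𝓡 n) p) (τ : M → ℝ) : Prop :=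
  MemLp τ 2 (surfaceMeasure n Ω) ∧
  ∃ (f : ℕ → M → ℝ) (Y : ℕ → ∀ p : M, TangentSpace (𝓡 n) p),
    (∀ k, ContMDiff (𝓡 n) 𝓘(ℝ, ℝ) ∞ (f k) ∧ IsWeakGradient n Ω (f k) (Y k)) ∧
    Tendsto (fun k => h1DistSq n Ω u X (f k) (Y k)) atTop (𝓝 0) ∧
    Tendsto (fun k => eLpNorm (fun p => f k p - τ p) 2 (surfaceMeasure n Ω)) atTop (𝓝 0)

end Sobolev

/-! ## Boundary conditions and eigenfunctions -/

/-- The boundary conditions: `closed` (no boundary), Dirichlet, Neumann, mixed Dirichlet-Neumann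
(Dirichlet on `Γ₀`, Neumann on `Γ₁`), and Robin `∂y/∂n + β y = 0`. -/
inductive BdryCond (M : Type*) : Type _
  | closed
  | dirichlet
  | neumann
  | mixed (Γ₀ Γ₁ : Set M)
  | robin (β : M → ℝ)

namespace BdryCond

/-- The cases in which the constants are in the kernel of the Laplacian, so that the state space
consists of the functions with mean zero. -/
def MeanZero {M : Type*} : BdryCond M → Prop
  | closed => True
  | neumann => True
  | _ => False

variable (n : ℕ) {M : Type*} [EMetricSpace M] [ChartedSpace (EuclideanSpace ℝ (Fin n)) M]
  [RiemannianBundle (fun x : M => TangentSpace (𝓡 n) x)] [MeasurableSpace M] [BorelSpace M]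

/-- The boundary condition is one that can be imposed on `∂Ω`. -/
def Admissible (Ω : Set M) : BdryCond M → Prop
  | closed => frontier Ω = ∅
  | dirichlet => (frontier Ω).Nonempty
  | neumann => (frontier Ω).Nonempty
  | mixed Γ₀ Γ₁ => (frontier Ω).Nonempty ∧ Γ₀ ∪ Γ₁ = frontier Ω ∧ Γ₀ ∩ Γ₁ = ∅ ∧
      NullMeasurableSet Γ₀ (surfaceMeasure n Ω) ∧ NullMeasurableSet Γ₁ (surfaceMeasure n Ω)
  | robin β => (frontier Ω).Nonempty ∧ AEStronglyMeasurable β (surfaceMeasure n Ω) ∧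
      (∀ x ∈ frontier Ω, 0 ≤ β x) ∧ (∃ C : ℝ, ∀ x ∈ frontier Ω, β x ≤ C) ∧
      0 < ∫ x, β x ∂(surfaceMeasure n Ω)

/-- `u` is in the state space `X`: the space `L²₀(Ω, ℂ)` of functions with mean zero in the
boundaryless and Neumann cases, and `L²(Ω, ℂ)` otherwise. -/
def InStateSpace (bc : BdryCond M) (Ω : Set M) (u : M → ℂ) : Prop :=
  MemLp u 2 ((riemVol n M).restrict Ω) ∧
    (bc.MeanZero → ∫ p in Ω, u p ∂(riemVol n M) = 0)

/-- `u` (with weak gradient `X`) is in the (real) domain of the quadratic form of the Laplacian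
with the given boundary condition, that is, in `D(A^{1/2})`. -/
def InFormDomain (bc : BdryCond M) (Ω : Set M) (u : M → ℝ)
    (X : ∀ p : M, TangentSpace (𝓡 n) p) : Prop :=
  match bc with
  | closed => MemH1 n Ω u X ∧ ∫ p in Ω, u p ∂(riemVol n M) = 0
  | dirichlet => MemH10 n Ω u X
  | neumann => MemH1 n Ω u X ∧ ∫ p in Ω, u p ∂(riemVol n M) = 0
  | mixed Γ₀ _ => MemH1 n Ω u X ∧
      ∃ τ : M → ℝ, IsTrace n Ω u X τ ∧ ∀ᵐ x ∂(surfaceMeasure n Ω), x ∈ Γ₀ → τ x = 0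
  | robin _ => MemH1 n Ω u X ∧ ∃ τ : M → ℝ, IsTrace n Ω u X τ

/-- `b` is the boundary term of the quadratic form at `(u, v)`: the integral `∫_{∂Ω} β u v` (of the
traces) in the Robin case, and `0` otherwise. -/
def IsBoundaryTerm (bc : BdryCond M) (Ω : Set M) (u : M → ℝ) (X : ∀ p : M, TangentSpace (𝓡 n) p)
    (v : M → ℝ) (Y : ∀ p : M, TangentSpace (𝓡 n) p) (b : ℝ) : Prop :=
  match bc with
  | robin β => ∃ τ τ' : M → ℝ, IsTrace n Ω u X τ ∧ IsTrace n Ω v Y τ' ∧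
      b = ∫ x, β x * τ x * τ' x ∂(surfaceMeasure n Ω)
  | _ => b = 0

/-- `u` is a (real) eigenfunction, for the eigenvalue `μ`, of `A = -Δ_g` on `Ω` with the given
boundary condition: `u ≠ 0`, `u` is in the form domain, and
`∫_Ω g(∇u, ∇v) dV_g + (boundary term) = μ ∫_Ω u v dV_g` for all `v` in the form domain. -/
def IsEigenfunction (bc : BdryCond M) (Ω : Set M) (μ : ℝ) (u : M → ℝ) : Prop :=
  ¬ (u =ᵐ[(riemVol n M).restrict Ω] 0) ∧
  ∃ X : ∀ p : M, TangentSpace (𝓡 n) p, bc.InFormDomain n Ω u X ∧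
    ∀ (v : M → ℝ) (Y : ∀ p : M, TangentSpace (𝓡 n) p) (b : ℝ),
      bc.InFormDomain n Ω v Y → bc.IsBoundaryTerm n Ω u X v Y b →
      ∫ p in Ω, (inner ℝ (X p) (Y p) : ℝ) ∂(riemVol n M) + b
        = μ * ∫ p in Ω, u p * v p ∂(riemVol n M)

/-- `φ` is an orthonormal Hilbert basis of the state space consisting of (real) eigenfunctions
of `A`, associated with the positive eigenvalues `λ_j²`. -/
structure IsEigenbasis (bc : BdryCond M) (Ω : Set M) (φ : ℕ → M → ℝ) : Prop where
  inStateSpace : ∀ j, bc.InStateSpace n Ω (fun p => (φ j p : ℂ))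
  orthonormal : ∀ j k, ∫ p in Ω, φ j p * φ k p ∂(riemVol n M) = if j = k then 1 else 0
  total : ∀ u : M → ℂ, bc.InStateSpace n Ω u →
    (∀ j, ∫ p in Ω, (φ j p : ℂ) * u p ∂(riemVol n M) = 0) →
    u =ᵐ[(riemVol n M).restrict Ω] 0
  eigen : ∃ lam : ℕ → ℝ, ∀ j, 0 < lam j ∧ bc.IsEigenfunction n Ω (lam j ^ 2) (φ j)

end BdryCond

/-! ## Quantum unique ergodicity, uniform bounds and Jordan measurable sets -/

section Ergodicity

variable (n : ℕ) {M : Type*} [EMetricSpace M] [ChartedSpace (EuclideanSpace ℝ (Fin n)) M]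
  [RiemannianBundle (fun x : M => TangentSpace (𝓡 n) x)] [MeasurableSpace M]

/-- Quantum Unique Ergodicity on the base: the whole sequence of measures `φ_j² dV_g` on `Ω`
converges vaguely (against continuous functions with compact support in `Ω`) to
`dV_g / V_g(Ω)`. -/
def QUE (Ω : Set M) (φ : ℕ → M → ℝ) : Prop :=
  ∀ f : M → ℝ, Continuous f → HasCompactSupport f → tsupport f ⊆ Ω →
    Tendsto (fun j => ∫ p in Ω, f p * φ j p ^ 2 ∂(riemVol n M)) atTop
      (𝓝 ((∫ p in Ω, f p ∂(riemVol n M)) / (riemVol n M).real Ω))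

/-- Uniform `L^p`-boundedness: the `φ_j` are bounded in `L^{2p}(Ω)` for some `p ∈ (1, +∞]`. -/
def UniformLpBounded (Ω : Set M) (φ : ℕ → M → ℝ) : Prop :=
  ∃ p : ℝ≥0∞, 1 < p ∧ ∃ A : ℝ, 0 < A ∧
    ∀ j, eLpNorm (φ j) (2 * p) ((riemVol n M).restrict Ω) ≤ ENNReal.ofReal A

/-- The Jordan measurable subsets of `Ω` (those whose boundary is of measure zero) of measure
`L V_g(Ω)`. -/
def JordanSets (Ω : Set M) (L : ℝ) : Set (Set M) :=
  {S | S ⊆ Ω ∧ NullMeasurableSet S (riemVol n M) ∧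
    riemVol n M S = ENNReal.ofReal L * riemVol n M Ω ∧ riemVol n M (frontier S) = 0}

/-- The functional `J(S) = inf_j ∫_S φ_j² dV_g`. -/
def J (φ : ℕ → M → ℝ) (S : Set M) : ℝ :=
  ⨅ j, ∫ p in S, φ j p ^ 2 ∂(riemVol n M)

end Ergodicity

end

/-! Put ν_j = φ_j² dV_g on Ω, and let ν' be the uniform probability measure on Ω. Hölder's
inequality turns the L^{2p} bound into uniform absolute continuity of the ν_j with respect to ν'
(`exists_pos_forall_lintegral_sq_le_of_eLpNorm_le`). This upgrades the vague convergence given by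
QUE to setwise convergence ν_j(E) → ν'(E) for every measurable E (`tendsto_measureReal_of_vague`).
The upper bound follows at once: the infimum over j is at most the limit, which is L.

For the lower bound, one set must catch almost the proportion L of all the ν_j simultaneously
(`exists_measurableSet_forall_abs_measureReal_sub_le`). The constant density a = L does so exactly,
and it is deformed into an almost-indicator by a deterministic walk (`exists_walk`). Each step adds
d cos(kX) where d ≤ a ≤ 1 - d, with X a function whose law has no singular part. For k large,
Riemann-Lebesgue makes the step invisible to the finitely many ν_j with j < N, and setwise
convergence makes it nearly invisible for j ≥ N'. Only the indices N ≤ j < N' feel it, by at most d.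
As the next step starts from N', no index suffers this loss twice, so the errors do not accumulate.
Meanwhile ∫ a² dν' grows by about d²/2 times the measure of the active region. Since it stays below
1, that region becomes small, and {a ≥ 1/2} is the required set.

It remains to make the set Jordan measurable. A compact subset of it is enclosed in a finite union
of coordinate balls, whose boundaries are null, and further balls are added until the volume is
exactly L V_g(Ω) (`exists_superset_null_frontier_measureReal_eq`). Enlarging can only increase each
ν_j. -/

/-! ### Sets of prescribed measure for a whole sequence of probability measures -/

section Oscillation

variable {α : Type*} [MeasurableSpace α]

/-- The Riemann-Lebesgue lemma for a function whose law is absolutely continuous. -/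
lemma tendsto_integral_cos_mul_of_map_absolutelyContinuous (ρ : Measure α) [IsFiniteMeasure ρ]
    {X : α → ℝ} (hX : Measurable X) (hac : ρ.map X ≪ volume) :
    Tendsto (fun k : ℕ => ∫ x, Real.cos (k * X x) ∂ρ) atTop (𝓝 0) := by
  set f : ℝ → ℝ := fun t => ((ρ.map X).rnDeriv volume t).toReal
  have key : ∀ k : ℕ, ∫ x, Real.cos (k * X x) ∂ρ = ∫ t, f t * Real.cos (k * t) := by
    intro k
    have h1 : ∫ x, Real.cos (k * X x) ∂ρ = ∫ t, Real.cos (k * t) ∂(ρ.map X) := by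
      rw [integral_map hX.aemeasurable (by fun_prop)]
    rw [h1, ← integral_rnDeriv_smul hac]
    rfl
  have hf : Integrable f := Measure.integrable_toReal_rnDeriv
  have hRL := Real.tendsto_integral_exp_smul_cocompact (fun t => (f t : ℂ))
  -- The Fourier kernel is exp(-2πi v w), so the frequency w = k/(2π) has real part cos(k v).
  have hlim : Tendsto (fun k : ℕ => (k : ℝ) / (2 * Real.pi)) atTop (cocompact ℝ) :=
    (tendsto_natCast_atTop_atTop.atTop_div_const (by positivity)).mono_right
      atTop_le_cocompact
  have h2 := (Complex.continuous_re.tendsto _).comp (hRL.comp hlim)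
  simp only [Complex.zero_re] at h2
  refine h2.congr fun k => ?_
  rw [key]
  simp only [Function.comp_apply]
  have hint : Integrable (fun v : ℝ =>
      Real.fourierChar (-(v * ((k : ℝ) / (2 * Real.pi)))) • (f v : ℂ)) := by
    have := (Real.fourierIntegral_convergent_iff (μ := volume) (f := fun t => (f t : ℂ))
      ((k : ℝ) / (2 * Real.pi))).2 hf.ofReal
    refine this.congr (ae_of_all _ fun v => ?_)
    simp [mul_comm]
  rw [← Complex.reCLM_apply, ← ContinuousLinearMap.integral_comp_comm _ hint]
  refine integral_congr_ae (ae_of_all _ fun v => ?_)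
  have : (2 * Real.pi * -(v * ((k : ℝ) / (2 * Real.pi)))) = -(k * v) := by
    field_simp
  simp only [Circle.smul_def, Real.fourierChar_apply, this, smul_eq_mul, Complex.reCLM_apply]
  rw [Complex.re_mul_ofReal, Complex.exp_ofReal_mul_I_re, Real.cos_neg, mul_comm]

/-- Setwise convergence of probability measures implies convergence of the integrals of bounded
measurable functions. -/
lemma tendsto_integral_of_tendsto_measureReal {ν : ℕ → Measure α} {ν' : Measure α}
    [∀ j, IsProbabilityMeasure (ν j)] [IsProbabilityMeasure ν']
    (hset : ∀ E, MeasurableSet E → Tendsto (fun j => (ν j).real E) atTop (𝓝 (ν'.real E)))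
    {h : α → ℝ} (hm : Measurable h) (hb : ∀ x, |h x| ≤ 1) :
    Tendsto (fun j => ∫ x, h x ∂(ν j)) atTop (𝓝 (∫ x, h x ∂ν')) := by
  -- The shift gives values in [0, 2], so the layer-cake formula applies: setwise convergence is
  -- pointwise convergence of the tail functions, dominated by the indicator of (0, 2].
  set g : α → ℝ := fun x => h x + 1
  have hgm : Measurable g := hm.add_const 1
  have hg0 : ∀ x, 0 ≤ g x := fun x => by linarith [(abs_le.1 (hb x)).1]
  have hg2 : ∀ x, g x ≤ 2 := fun x => by linarith [(abs_le.1 (hb x)).2]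
  have hint : ∀ (ρ : Measure α) [IsProbabilityMeasure ρ], Integrable h ρ := fun ρ _ =>
    Integrable.of_bound hm.aestronglyMeasurable 1 (ae_of_all _ fun x => by simpa using hb x)
  have key : ∀ (ρ : Measure α) [IsProbabilityMeasure ρ],
      ∫ x, h x ∂ρ = (∫ t in Ioi (0 : ℝ), ρ.real {a | t ≤ g a}) - 1 := by
    intro ρ _
    have hgi : Integrable g ρ := (hint ρ).add (integrable_const 1)
    rw [← hgi.integral_eq_integral_meas_le (ae_of_all _ hg0)]
    simp [g, integral_add (hint ρ) (integrable_const 1)]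
  simp only [key]
  refine Tendsto.sub_const ?_ 1
  refine tendsto_integral_of_dominated_convergence ((Ioc (0 : ℝ) 2).indicator 1) ?_ ?_ ?_ ?_
  · intro j
    have : Antitone fun t : ℝ => (ν j).real {a | t ≤ g a} := fun s t hst =>
      measureReal_mono fun a ha => hst.trans ha
    exact this.measurable.aestronglyMeasurable
  · refine (IntegrableOn.integrable_indicator ?_ measurableSet_Ioc).integrableOn
    exact integrableOn_const (by simp)
  · intro j
    refine (ae_restrict_mem measurableSet_Ioi).mono fun t ht => ?_
    by_cases h2 : t ≤ 2
    · have ht2 : t ∈ Ioc (0 : ℝ) 2 := ⟨ht, h2⟩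
      rw [indicator_of_mem ht2, Real.norm_of_nonneg measureReal_nonneg]
      exact measureReal_le_one
    · have : {a | t ≤ g a} = ∅ := by
        ext a
        simp only [mem_ofPred_eq, mem_empty_iff_false, iff_false, not_le]
        linarith [hg2 a]
      rw [this]
      simp [h2]
  · exact ae_of_all _ fun t => hset _ (measurableSet_le measurable_const hgm)

omit [MeasurableSpace α] in
lemma abs_indicator_cos_le_one (U : Set α) (Y : α → ℝ) (x : α) :
    |U.indicator (fun y => Real.cos (Y y)) x| ≤ 1 := by
  by_cases hx : x ∈ U
  · simpa [hx] using Real.abs_cos_le_one _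
  · simp [hx]

lemma abs_integral_indicator_cos_le_one (ρ : Measure α) [IsProbabilityMeasure ρ]
    (U : Set α) (Y : α → ℝ) : |∫ x, U.indicator (fun y => Real.cos (Y y)) x ∂ρ| ≤ 1 := by
  have := norm_integral_le_of_norm_le_const (μ := ρ) (f := U.indicator fun y => Real.cos (Y y)) (C := 1)
    (ae_of_all _ (abs_indicator_cos_le_one U Y))
  simpa using this

/-- One step of the oscillating walk. -/
lemma exists_oscillation_step {ν : ℕ → Measure α} {ν' : Measure α}
    [∀ j, IsProbabilityMeasure (ν j)] [IsProbabilityMeasure ν']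
    (hset : ∀ E, MeasurableSet E → Tendsto (fun j => (ν j).real E) atTop (𝓝 (ν'.real E)))
    (hνac : ∀ j, ν j ≪ ν') {X : α → ℝ} (hX : Measurable X) (hac : ν'.map X ≪ volume)
    {a : α → ℝ} (ha : Measurable a) (ha0 : ∀ x, 0 ≤ a x) (ha1 : ∀ x, a x ≤ 1)
    {U : Set α} (hU : MeasurableSet U) {η : ℝ} (hη : 0 < η) (N : ℕ) :
    ∃ Y : α → ℝ, Measurable Y ∧
      (∀ j < N, |∫ x, U.indicator (fun y => Real.cos (Y y)) x ∂(ν j)| ≤ η) ∧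
      (∃ N' ≥ N, ∀ j ≥ N', |∫ x, U.indicator (fun y => Real.cos (Y y)) x ∂(ν j)| ≤ 2 * η) ∧
      |∫ x, a x * U.indicator (fun y => Real.cos (Y y)) x ∂ν'| ≤ η ∧
      |∫ x, U.indicator (fun y => Real.cos (2 * Y y)) x ∂ν'| ≤ η := by
  -- Riemann-Lebesgue thus applies to every ρ ≪ ν', in particular to restrictions to `U` and to the
  -- density `a`.
  have hac' : ∀ ρ : Measure α, ρ ≪ ν' → ρ.map X ≪ volume := fun ρ h => (h.map hX).trans hac
  have small : ∀ {u : ℕ → ℝ}, Tendsto u atTop (𝓝 0) → ∀ᶠ k in atTop, |u k| ≤ η := fun h => by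
    filter_upwards [(tendsto_zero_iff_abs_tendsto_zero _).1 h |>.eventually_le_const hη] with k hk
    exact hk
  have hcosm : ∀ k : ℕ, Measurable fun x => Real.cos (k * X x) := fun k => by fun_prop
  have e1 : ∀ ρ : Measure α, IsProbabilityMeasure ρ → ρ ≪ ν' →
      Tendsto (fun k : ℕ => ∫ x, U.indicator (fun y => Real.cos (k * X y)) x ∂ρ) atTop (𝓝 0) := by
    intro ρ _ h
    simp only [integral_indicator hU]
    exact tendsto_integral_cos_mul_of_map_absolutelyContinuous _ hX
      (hac' _ (Measure.absolutelyContinuous_of_le Measure.restrict_le_self |>.trans h))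
  have e2 : Tendsto (fun k : ℕ => ∫ x, a x * U.indicator (fun y => Real.cos (k * X y)) x ∂ν')
      atTop (𝓝 0) := by
    have hfin : IsFiniteMeasure ((ν'.restrict U).withDensity fun x => ENNReal.ofReal (a x)) := by
      refine isFiniteMeasure_withDensity (ne_of_lt ?_)
      calc ∫⁻ x in U, ENNReal.ofReal (a x) ∂ν' ≤ ∫⁻ x in U, 1 ∂ν' :=
            lintegral_mono fun x => by simpa using ha1 x
        _ < ⊤ := by simp
    have := tendsto_integral_cos_mul_of_map_absolutelyContinuous
      ((ν'.restrict U).withDensity fun x => ENNReal.ofReal (a x)) hX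
      (hac' _ ((withDensity_absolutelyContinuous _ _).trans
        (Measure.absolutelyContinuous_of_le Measure.restrict_le_self)))
    refine this.congr fun k => ?_
    rw [integral_withDensity_eq_integral_toReal_smul ha.ennreal_ofReal
      (ae_of_all _ fun x => ENNReal.ofReal_lt_top), ← integral_indicator hU]
    refine integral_congr_ae (ae_of_all _ fun x => ?_)
    by_cases hx : x ∈ U <;> simp [hx, ENNReal.toReal_ofReal (ha0 x)]
  have e3 : Tendsto (fun k : ℕ => ∫ x, U.indicator (fun y => Real.cos (2 * (k * X y))) x ∂ν')
      atTop (𝓝 0) := by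
    have h2 : Tendsto (fun k : ℕ => 2 * k) atTop atTop :=
      tendsto_id.const_mul_atTop' (by norm_num)
    refine ((e1 ν' inferInstance Measure.AbsolutelyContinuous.rfl).comp h2).congr fun k => ?_
    simp [mul_assoc]
  have e4 : ∀ᶠ k : ℕ in atTop, ∀ j ∈ Finset.range N,
      |∫ x, U.indicator (fun y => Real.cos (k * X y)) x ∂(ν j)| ≤ η :=
    (Filter.eventually_all_finset _).2 fun j _ => small (e1 (ν j) inferInstance (hνac j))
  obtain ⟨k, h1, h2, h3, h4⟩ := (((small (e1 ν' inferInstance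
    Measure.AbsolutelyContinuous.rfl)).and (small e2)).and ((small e3).and e4)).exists.imp
    fun k h => (⟨h.1.1, h.1.2, h.2.1, h.2.2⟩ : _ ∧ _ ∧ _ ∧ _)
  refine ⟨fun x => k * X x, by fun_prop, fun j hj => h4 j (Finset.mem_range.2 hj), ?_, h2, h3⟩
  -- With k now fixed, the integrals against ν_j converge to the one against ν', which is at most η
  -- in absolute value; hence the bound 2η on a tail.
  have ht := tendsto_integral_of_tendsto_measureReal hset ((hcosm k).indicator hU)
    (abs_indicator_cos_le_one U _)
  have ht' := ht.abs.eventually_le_const (show _ < 2 * η by linarith)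
  obtain ⟨N', hN'⟩ := (ht'.and (eventually_ge_atTop N)).exists_forall_of_atTop
  exact ⟨N', (hN' N' le_rfl).2, fun j hj => (hN' j hj).1⟩

/-- The oscillating walk, absorbed near `0` and `1`. -/
lemma exists_walk {ν : ℕ → Measure α} {ν' : Measure α}
    [∀ j, IsProbabilityMeasure (ν j)] [IsProbabilityMeasure ν']
    (hset : ∀ E, MeasurableSet E → Tendsto (fun j => (ν j).real E) atTop (𝓝 (ν'.real E)))
    (hνac : ∀ j, ν j ≪ ν') {X : α → ℝ} (hX : Measurable X) (hac : ν'.map X ≪ volume)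
    {L : ℝ} (hL0 : 0 ≤ L) (hL1 : L ≤ 1) {d η : ℝ} (hd : 0 < d) (hd1 : d ≤ 1) (hη : 0 < η)
    (i : ℕ) :
    ∃ (a : α → ℝ) (N : ℕ), Measurable a ∧ (∀ x, 0 ≤ a x) ∧ (∀ x, a x ≤ 1) ∧
      (∀ j ≥ N, |∫ x, a x ∂(ν j) - L| ≤ 2 * i * η) ∧
      (∀ j, |∫ x, a x ∂(ν j) - L| ≤ 2 * i * η + d) ∧
      i * (d ^ 2 / 2 * ν'.real {x | d ≤ a x ∧ a x ≤ 1 - d}) ≤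
        ∫ x, a x ^ 2 ∂ν' + 3 * i * η := by
  induction i with
  | zero =>
    refine ⟨fun _ => L, 0, measurable_const, fun _ => hL0, fun _ => hL1, ?_, ?_, ?_⟩
    · simp
    · simp [hd.le]
    · simp; positivity
  | succ i ih =>
    obtain ⟨a, N, ha, ha0, ha1, hge, hall, hsq⟩ := ih
    set U : Set α := {x | d ≤ a x ∧ a x ≤ 1 - d} with hUdef
    have hU : MeasurableSet U :=
      (measurableSet_le measurable_const ha).inter (measurableSet_le ha measurable_const)
    obtain ⟨Y, hY, hlt, ⟨N', hNN', hgt⟩, haY, hY2⟩ :=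
      exists_oscillation_step hset hνac hX hac ha ha0 ha1 hU hη N
    set c : α → ℝ := U.indicator (fun y => Real.cos (Y y)) with hc
    have hcm : Measurable c := (Real.measurable_cos.comp hY).indicator hU
    have hc1 : ∀ x, |c x| ≤ 1 := abs_indicator_cos_le_one U Y
    have hci : ∀ (ρ : Measure α) [IsProbabilityMeasure ρ], Integrable c ρ := fun ρ _ =>
      Integrable.of_bound hcm.aestronglyMeasurable 1 (ae_of_all _ fun x => by simpa using hc1 x)
    have hai : ∀ (ρ : Measure α) [IsProbabilityMeasure ρ], Integrable a ρ := fun ρ _ =>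
      Integrable.of_bound ha.aestronglyMeasurable 1
        (ae_of_all _ fun x => by simpa [abs_of_nonneg (ha0 x)] using ha1 x)
    have hsum : ∀ j, ∫ x, (a x + d * c x) ∂(ν j) - L
        = (∫ x, a x ∂(ν j) - L) + d * ∫ x, c x ∂(ν j) := fun j => by
      rw [integral_add (hai _) ((hci _).const_mul d), integral_const_mul]
      ring
    have hdc : ∀ {u v : ℝ}, |u| ≤ v → |d * u| ≤ v := fun {u v} h => by
      rw [abs_mul, abs_of_pos hd]
      exact (mul_le_of_le_one_left (abs_nonneg u) hd1).trans h
    have hmem : ∀ x, 0 ≤ a x + d * c x ∧ a x + d * c x ≤ 1 := by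
      intro x
      by_cases hx : x ∈ U
      · have h1 := abs_le.1 (hc1 x)
        have hx' : d ≤ a x ∧ a x ≤ 1 - d := hx
        constructor <;> nlinarith
      · have : c x = 0 := by simp [hc, hx]
        simp [this, ha0 x, ha1 x]
    -- Absorbed points stay absorbed. The active regions therefore decrease, and the gain of every
    -- earlier step is bounded below through the last region.
    have hsub : {x | d ≤ a x + d * c x ∧ a x + d * c x ≤ 1 - d} ⊆ U := by
      intro x hx
      by_contra hxU
      have : c x = 0 := by simp [hc, hxU]
      simp only [mem_ofPred_eq, this, mul_zero, add_zero] at hx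
      exact hxU hx
    refine ⟨fun x => a x + d * c x, N', ha.add (hcm.const_mul d), fun x => (hmem x).1,
      fun x => (hmem x).2, fun j hj => ?_, fun j => ?_, ?_⟩
    · rw [hsum]
      have h1 := hge j (hNN'.trans hj)
      have h2 := hdc (hgt j hj)
      push_cast
      linarith [abs_add_le (∫ x, a x ∂(ν j) - L) (d * ∫ x, c x ∂(ν j))]
    · rw [hsum]
      have h3 := abs_add_le (∫ x, a x ∂(ν j) - L) (d * ∫ x, c x ∂(ν j))
      push_cast
      -- For j < N the old error may already contain d, but the increment is at most η; for j ≥ N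
      -- the old error is free of d, so an increment of size d is affordable.
      rcases lt_or_ge j N with hj | hj
      · linarith [hall j, hdc (hlt j hj)]
      · have h4 : |d * ∫ x, c x ∂(ν j)| ≤ d := by
          rw [abs_mul, abs_of_pos hd]
          exact mul_le_of_le_one_right hd.le (abs_integral_indicator_cos_le_one _ _ _)
        linarith [hge j hj]
    · have hmono : ν'.real {x | d ≤ a x + d * c x ∧ a x + d * c x ≤ 1 - d} ≤ ν'.real U :=
        measureReal_mono hsub
      -- From cos² = (1 + cos 2Y)/2 on `U`. The cross term costs at most 2η and the double-frequency
      -- term at most η, whence 3η per step.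
      have hexp : ∀ x, (a x + d * c x) ^ 2 = a x ^ 2 + 2 * d * (a x * c x)
          + d ^ 2 / 2 * (U.indicator 1 x + U.indicator (fun y => Real.cos (2 * Y y)) x) := by
        intro x
        by_cases hx : x ∈ U
        · simp only [hc, hx, indicator_of_mem, Real.cos_two_mul, Pi.one_apply]
          ring
        · simp [hc, hx]
      have i1 : Integrable (fun x => a x ^ 2) ν' :=
        Integrable.of_bound (ha.pow_const 2).aestronglyMeasurable 1 (ae_of_all _ fun x => by
          rw [Real.norm_of_nonneg (by positivity)]
          exact pow_le_one₀ (ha0 x) (ha1 x))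
      have i2 : Integrable (fun x => a x * c x) ν' :=
        Integrable.of_bound (ha.mul hcm).aestronglyMeasurable 1 (ae_of_all _ fun x => by
          rw [norm_mul, Real.norm_of_nonneg (ha0 x)]
          exact mul_le_one₀ (ha1 x) (norm_nonneg _) (hc1 x))
      have i3 : Integrable (U.indicator (1 : α → ℝ)) ν' :=
        (integrable_const (1 : ℝ)).indicator hU
      have i4 : Integrable (U.indicator (fun y => Real.cos (2 * Y y))) ν' :=
        Integrable.of_bound (((Real.measurable_cos.comp
          (hY.const_mul 2)).indicator hU).aestronglyMeasurable) 1
          (ae_of_all _ fun x => abs_indicator_cos_le_one U _ x)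
      have hval : ∫ x, (a x + d * c x) ^ 2 ∂ν' = ∫ x, a x ^ 2 ∂ν' + 2 * d * ∫ x, a x * c x ∂ν'
          + d ^ 2 / 2 * (ν'.real U
            + ∫ x, U.indicator (fun y => Real.cos (2 * Y y)) x ∂ν') := by
        simp only [hexp]
        have i5 : Integrable (fun x => a x ^ 2 + 2 * d * (a x * c x)) ν' := i1.add (i2.const_mul _)
        have i6 : Integrable (fun x => U.indicator (1 : α → ℝ) x
            + U.indicator (fun y => Real.cos (2 * Y y)) x) ν' := i3.add i4
        rw [integral_add i5 (i6.const_mul _),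
          integral_add i1 (i2.const_mul _), integral_const_mul, integral_const_mul,
          integral_add i3 i4, integral_indicator_one hU]
      rw [hval]
      push_cast
      have hd2 : d ^ 2 / 2 ≤ 1 := by nlinarith
      have hp : 0 ≤ d ^ 2 / 2 := by positivity
      have b1 : -(2 * η) ≤ 2 * d * ∫ x, a x * c x ∂ν' := by
        have := (abs_le.1 (hdc haY)).1
        nlinarith
      have b2 : -η ≤ d ^ 2 / 2 * ∫ x, U.indicator (fun y => Real.cos (2 * Y y)) x ∂ν' := by
        have := (abs_le.1 hY2).1
        nlinarith
      have b3 : ((i : ℝ) + 1) * (d ^ 2 / 2 *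
          ν'.real {x | d ≤ a x + d * c x ∧ a x + d * c x ≤ 1 - d}) ≤
          (i + 1) * (d ^ 2 / 2 * ν'.real U) := by gcongr
      linarith

/-- If the probability measures `ν j` converge setwise to a limit with an absolutely continuous
real-valued observable, and are uniformly absolutely continuous with respect to this limit, then
there is a set whose measure is close to `L` for all of them at once. -/
theorem exists_measurableSet_forall_abs_measureReal_sub_le {ν : ℕ → Measure α} {ν' : Measure α}
    [∀ j, IsProbabilityMeasure (ν j)] [IsProbabilityMeasure ν']
    (hset : ∀ E, MeasurableSet E → Tendsto (fun j => (ν j).real E) atTop (𝓝 (ν'.real E)))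
    (hUI : ∀ ε > 0, ∃ δ > 0, ∀ E, MeasurableSet E → ν'.real E < δ → ∀ j, (ν j).real E ≤ ε)
    {X : α → ℝ} (hX : Measurable X) (hac : ν'.map X ≪ volume)
    {L : ℝ} (hL0 : 0 ≤ L) (hL1 : L ≤ 1) {ε : ℝ} (hε : 0 < ε) :
    ∃ S, MeasurableSet S ∧ ∀ j, |(ν j).real S - L| ≤ ε := by
  have hνac : ∀ j, ν j ≪ ν' := by
    refine fun j => Measure.AbsolutelyContinuous.mk fun E hE h0 => ?_
    have : (ν j).real E ≤ 0 := le_of_forall_pos_le_add fun e he => by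
      obtain ⟨δ, hδ, h⟩ := hUI e he
      simpa using h E hE (by simpa [measureReal_def, h0] using hδ) j
    have h1 : (ν j).real E = 0 := le_antisymm this measureReal_nonneg
    exact (measureReal_eq_zero_iff (measure_ne_top _ _)).1 h1
  obtain ⟨δ, hδ, hδU⟩ := hUI (ε / 4) (by positivity)
  -- Since d ≤ 1/2, rounding `a` at 1/2 off the active region moves it by less than d.
  set d := min (ε / 4) (1 / 2)
  have hd : 0 < d := by positivity
  have hdε : d ≤ ε / 4 := min_le_left _ _
  have hd2 : d ≤ 1 / 2 := min_le_right _ _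
  obtain ⟨m, hm⟩ := exists_nat_gt (4 / (d ^ 2 * δ))
  have hm0 : (0 : ℝ) < m := lt_of_le_of_lt (by positivity) hm
  -- The walk shifts the mean by at most 2mη + d ≤ 2d ≤ ε/2, and rounding by at most d + ε/4 ≤ ε/2.
  -- If the active region had measure at least δ, then m d²δ/2 ≤ 1 + 3mη ≤ 1 + m d²δ/4, against m
  -- d²δ > 4.
  set η := min (d / (2 * m)) (d ^ 2 * δ / 12)
  have hη : 0 < η := by positivity
  have hη1 : 2 * m * η ≤ d := by
    have : η ≤ d / (2 * m) := min_le_left _ _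
    rw [le_div_iff₀ (by positivity)] at this
    linarith
  have hη2 : η ≤ d ^ 2 * δ / 12 := min_le_right _ _
  obtain ⟨a, N, ha, ha0, ha1, -, hall, hsq⟩ :=
    exists_walk hset hνac hX hac hL0 hL1 hd (by linarith) hη m
  set U : Set α := {x | d ≤ a x ∧ a x ≤ 1 - d}
  have hU : MeasurableSet U :=
    (measurableSet_le measurable_const ha).inter (measurableSet_le ha measurable_const)
  have hai : ∀ (ρ : Measure α) [IsProbabilityMeasure ρ], Integrable a ρ := fun ρ _ =>
    Integrable.of_bound ha.aestronglyMeasurable 1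
      (ae_of_all _ fun x => by simpa [abs_of_nonneg (ha0 x)] using ha1 x)
  have hUδ : ν'.real U < δ := by
    have h1 : ∫ x, a x ^ 2 ∂ν' ≤ 1 := by
      have := integral_mono_of_nonneg (μ := ν') (ae_of_all _ fun x => by positivity)
        (integrable_const (1 : ℝ)) (ae_of_all _ fun x => pow_le_one₀ (n := 2) (ha0 x) (ha1 x))
      simpa using this
    rw [div_lt_iff₀ (by positivity)] at hm
    by_contra! hcon
    have h2 : m * (d ^ 2 / 2 * δ) ≤ m * (d ^ 2 / 2 * ν'.real U) := by gcongr
    have h3 : 3 * m * η ≤ 3 * m * (d ^ 2 * δ / 12) := by gcongr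
    nlinarith
  set S : Set α := {x | 1 / 2 ≤ a x}
  have hS : MeasurableSet S := measurableSet_le measurable_const ha
  refine ⟨S, hS, fun j => ?_⟩
  have hdiff : |(ν j).real S - ∫ x, a x ∂(ν j)| ≤ d + ε / 4 := by
    have hSi : Integrable (S.indicator (1 : α → ℝ)) (ν j) := (integrable_const 1).indicator hS
    rw [← integral_indicator_one hS, ← integral_sub hSi (hai _)]
    refine (abs_integral_le_integral_abs).trans ?_
    have hb : ∀ x, |S.indicator (1 : α → ℝ) x - a x| ≤ d + U.indicator 1 x := by
      intro x
      by_cases hxU : x ∈ U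
      · simp only [hxU, indicator_of_mem, Pi.one_apply]
        by_cases hxS : x ∈ S
        · simp only [hxS, indicator_of_mem, Pi.one_apply]
          rw [abs_le]; constructor <;> linarith [ha0 x, ha1 x]
        · simp only [hxS, not_false_eq_true, indicator_of_notMem]
          rw [abs_le]; constructor <;> linarith [ha0 x, ha1 x]
      · simp only [hxU, not_false_eq_true, indicator_of_notMem, add_zero]
        by_cases hxS : x ∈ S
        · simp only [hxS, indicator_of_mem, Pi.one_apply]
          have h1 : 1 / 2 ≤ a x := hxS
          have h2 : 1 - d < a x := by
            by_contra! h
            exact hxU ⟨by linarith, h⟩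
          rw [abs_le]; constructor <;> linarith [ha1 x]
        · simp only [hxS, not_false_eq_true, indicator_of_notMem]
          have h1 : a x < 1 / 2 := not_le.1 hxS
          have h2 : a x < d := by
            by_contra! h
            exact hxU ⟨h, by linarith⟩
          rw [abs_le]; constructor <;> linarith [ha0 x]
    calc ∫ x, |S.indicator (1 : α → ℝ) x - a x| ∂(ν j)
        ≤ ∫ x, (d + U.indicator (1 : α → ℝ) x) ∂(ν j) :=
          integral_mono_of_nonneg (ae_of_all _ fun x => abs_nonneg _)
            ((integrable_const d).add ((integrable_const (1 : ℝ)).indicator hU)) (ae_of_all _ hb)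
      _ = d + (ν j).real U := by
          have hUi : Integrable (U.indicator (1 : α → ℝ)) (ν j) :=
            (integrable_const 1).indicator hU
          rw [integral_add (integrable_const d) hUi, integral_indicator_one hU]
          simp
      _ ≤ d + ε / 4 := by linarith [hδU U hU hUδ j]
  have h4 := abs_sub_le ((ν j).real S) (∫ x, a x ∂(ν j)) L
  linarith [hall j]

end Oscillation

/-! ### Null sets, finiteness and coordinate balls for the Riemannian volume -/

lemma ContinuousOn.measurableSet_inter_preimage {α β : Type*} [TopologicalSpace α]
    [MeasurableSpace α] [OpensMeasurableSpace α] [TopologicalSpace β] [MeasurableSpace β]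
    [BorelSpace β] {f : α → β} {s : Set α} (hf : ContinuousOn f s) (hs : MeasurableSet s)
    {Z : Set β} (hZ : MeasurableSet Z) : MeasurableSet (s ∩ f ⁻¹' Z) := by
  have h : s ∩ f ⁻¹' Z = Subtype.val '' (s.domRestrict f ⁻¹' Z) := by
    ext x
    simp [and_comm]
  rw [h]
  exact hs.subtype_image ((continuousOn_iff_continuous_domRestrict.1 hf).measurable hZ)

section Charts

variable {n : ℕ} {M : Type*} [EMetricSpace M] [ChartedSpace (EuclideanSpace ℝ (Fin n)) M]

/-- The image of a Lebesgue-null set of one chart is Lebesgue-null in every other chart. -/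
lemma volume_chart_transition_null [IsManifold (𝓡 n) ∞ M] (c c' : M)
    {Z : Set (EuclideanSpace ℝ (Fin n))} (hZ : volume Z = 0) :
    volume ((chartAt (EuclideanSpace ℝ (Fin n)) c').target ∩
      (chartAt (EuclideanSpace ℝ (Fin n)) c').symm ⁻¹'
        ((chartAt (EuclideanSpace ℝ (Fin n)) c).source ∩
          (chartAt (EuclideanSpace ℝ (Fin n)) c) ⁻¹' Z)) = 0 := by
  set e := chartAt (EuclideanSpace ℝ (Fin n)) c
  set e' := chartAt (EuclideanSpace ℝ (Fin n)) c'
  set D : Set (EuclideanSpace ℝ (Fin n)) := e.target ∩ e.symm ⁻¹' e'.source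
  -- Differentiable maps between spaces of equal dimension send null sets to null sets.
  have hdiff : DifferentiableOn ℝ (e' ∘ e.symm) D := by
    have h1 : ContMDiffOn (𝓡 n) (𝓡 n) ∞ (e' ∘ e.symm) D :=
      (contMDiffOn_chart (I := 𝓡 n) (n := ∞) (x := c')).comp
        ((contMDiffOn_chart_symm (I := 𝓡 n) (n := ∞) (x := c)).mono inter_subset_left)
        inter_subset_right
    exact (contMDiffOn_iff_contDiffOn.1 h1).differentiableOn (by simp)
  refine measure_mono_null ?_ (addHaar_image_eq_zero_of_differentiableOn_of_addHaar_eq_zero volume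
    (hdiff.mono (inter_subset_left (t := Z))) (measure_mono_null inter_subset_right hZ))
  rintro y ⟨hy, hys, hyZ⟩
  refine ⟨e (e'.symm y), ⟨⟨e.map_source hys, ?_⟩, hyZ⟩, ?_⟩
  · simp only [mem_preimage, e.left_inv hys]
    exact e'.map_target hy
  · simp only [Function.comp_apply, e.left_inv hys, e'.right_inv hy]

variable [RiemannianBundle (fun x : M => TangentSpace (𝓡 n) x)] [MeasurableSpace M] [BorelSpace M]

/-- Null sets of a chart are null for the Riemannian volume. -/
lemma riemVol_chart_preimage_null [IsManifold (𝓡 n) ∞ M] (c : M)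
    {Z : Set (EuclideanSpace ℝ (Fin n))} (hZ : volume Z = 0) :
    riemVol n M ((chartAt (EuclideanSpace ℝ (Fin n)) c).source ∩
      (chartAt (EuclideanSpace ℝ (Fin n)) c) ⁻¹' Z) = 0 := by
  refine measure_mono_null (inter_subset_inter_right _ (preimage_mono (subset_toMeasurable volume Z)))
    ?_
  have hZ' : volume (toMeasurable volume Z) = 0 := by rwa [measure_toMeasurable]
  have hm : MeasurableSet ((chartAt (EuclideanSpace ℝ (Fin n)) c).source ∩
      (chartAt (EuclideanSpace ℝ (Fin n)) c) ⁻¹' (toMeasurable volume Z)) :=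
    ContinuousOn.measurableSet_inter_preimage (chartAt (EuclideanSpace ℝ (Fin n)) c).continuousOn
      (chartAt (EuclideanSpace ℝ (Fin n)) c).open_source.measurableSet
      (measurableSet_toMeasurable _ _)
  rw [riemVol, Measure.sum_apply_eq_zero' hm]
  intro c'
  refine withDensity_absolutelyContinuous _ _ ?_
  rw [chartVolume]
  -- `Measure.map` is zero by convention for a map that is not a.e. measurable, which settles the
  -- second case.
  by_cases hae : AEMeasurable (chartAt (EuclideanSpace ℝ (Fin n)) c').symm
    (((volume : Measure (EuclideanSpace ℝ (Fin n))).restrict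
      (chartAt (EuclideanSpace ℝ (Fin n)) c').target).withDensity
    (fun y => ENNReal.ofReal (Real.sqrt (metricMatrix n c' y).det)))
  · rw [Measure.map_apply_of_aemeasurable hae hm]
    refine withDensity_absolutelyContinuous _ _ ?_
    rw [Measure.restrict_apply' (chartAt (EuclideanSpace ℝ (Fin n)) c').open_target.measurableSet,
      inter_comm]
    exact volume_chart_transition_null c c' hZ'
  · rw [Measure.map_of_not_aemeasurable hae]
    rfl

-- The coordinate fields are images of constant fields under the tangent map of the inverse chart,
-- hence continuous, and so are their inner products. This bounds the density √(det g) on compact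
-- subsets of a chart.
omit [MeasurableSpace M] [BorelSpace M] in
lemma continuousOn_metricMatrix [IsManifold (𝓡 n) ∞ M]
    [IsContMDiffRiemannianBundle (𝓡 n) ∞ (EuclideanSpace ℝ (Fin n))
      (fun x : M => TangentSpace (𝓡 n) x)] (c : M) :
    ContinuousOn (metricMatrix n c) (chartAt (EuclideanSpace ℝ (Fin n)) c).target := by
  set e := chartAt (EuclideanSpace ℝ (Fin n)) c with he
  have : IsManifold (𝓡 n) 1 M := IsManifold.of_le (n := ∞) (by simp)
  obtain ⟨g, hg, hg'⟩ := IsContMDiffRiemannianBundle.exists_contMDiff (IB := 𝓡 n) (n := ∞)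
    (F := EuclideanSpace ℝ (Fin n)) (E := fun x : M => TangentSpace (𝓡 n) x)
  have hR : IsContinuousRiemannianBundle (EuclideanSpace ℝ (Fin n))
    (fun x : M => TangentSpace (𝓡 n) x) := ⟨g, hg.continuous, hg'⟩
  have hT : ContinuousOn (tangentMapWithin (𝓡 n) (𝓡 n) e.symm e.target)
      (TotalSpace.proj ⁻¹' e.target) :=
    (contMDiffOn_chart_symm (I := 𝓡 n) (n := ∞) (x := c)).continuousOn_tangentMapWithin
      (by simp) e.open_target.uniqueMDiffOn
  have hv : ∀ v : EuclideanSpace ℝ (Fin n), ContinuousOn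
      (fun y => (⟨e.symm y, coordVec n c y v⟩ :
        TotalSpace (EuclideanSpace ℝ (Fin n)) (fun x : M => TangentSpace (𝓡 n) x))) e.target := by
    intro v
    have hs : Continuous (fun y : EuclideanSpace ℝ (Fin n) =>
        (⟨y, v⟩ : TangentBundle (𝓡 n) (EuclideanSpace ℝ (Fin n)))) :=
      (tangentBundleModelSpaceHomeomorph (𝓡 n)).symm.continuous.comp
        (continuous_id.prodMk continuous_const)
    have := hT.comp hs.continuousOn (s := e.target) (fun y hy => hy)
    refine this.congr fun y hy => ?_
    simp only [Function.comp_apply, tangentMapWithin, coordVec]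
    rw [mfderivWithin_of_isOpen e.open_target hy]
  refine continuousOn_pi.2 fun a => continuousOn_pi.2 fun b => ?_
  exact (hv _).inner_bundle (hv _)

/-- The Riemannian volume is finite on compact sets. -/
lemma riemVol_lt_top_of_isCompact [IsManifold (𝓡 n) ∞ M]
    [IsContMDiffRiemannianBundle (𝓡 n) ∞ (EuclideanSpace ℝ (Fin n))
      (fun x : M => TangentSpace (𝓡 n) x)] {K : Set M} (hK : IsCompact K) :
    riemVol n M K < ⊤ := by
  set ρ := chartPartition n M
  -- Local finiteness leaves finitely many terms, each carried by a compact subset of one chart,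
  -- where the density is bounded.
  have hfin : {c : M | (Function.support (ρ c) ∩ K).Nonempty}.Finite :=
    ρ.locallyFinite.finite_nonempty_inter_compact hK
  rw [riemVol, Measure.sum_apply _ hK.measurableSet, tsum_eq_sum (s := hfin.toFinset)]
  · refine ENNReal.sum_lt_top.2 fun c _ => ?_
    set e := chartAt (EuclideanSpace ℝ (Fin n)) c
    set K' := K ∩ tsupport (ρ c)
    have hK' : IsCompact K' := hK.inter_right (isClosed_tsupport _)
    have hsub : K' ⊆ e.source := inter_subset_right.trans (chartPartition_isSubordinate n M c)
    have hle : ((chartVolume n c).withDensity fun p => ENNReal.ofReal (ρ c p)) K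
        ≤ chartVolume n c K' := by
      rw [withDensity_apply _ hK.measurableSet, ← lintegral_indicator_one hK'.measurableSet,
        ← lintegral_indicator hK.measurableSet]
      refine lintegral_mono fun p => ?_
      by_cases hp : p ∈ K
      · by_cases hp' : p ∈ tsupport (ρ c)
        · simp [K', hp, hp', ρ.le_one c p]
        · simp [hp, image_eq_zero_of_notMem_tsupport hp']
      · simp [hp]
    refine hle.trans_lt ?_
    rw [chartVolume]
    by_cases hae : AEMeasurable e.symm
      (((volume : Measure (EuclideanSpace ℝ (Fin n))).restrict e.target).withDensity
      (fun y => ENNReal.ofReal (Real.sqrt (metricMatrix n c y).det)))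
    · have hKe : IsCompact (e '' K') := hK'.image_of_continuousOn (e.continuousOn.mono hsub)
      have hKt : e '' K' ⊆ e.target := by
        rintro _ ⟨p, hp, rfl⟩
        exact e.map_source (hsub hp)
      have heq : e.symm ⁻¹' K' ∩ e.target = e '' K' := by
        ext y
        constructor
        · rintro ⟨hy, hy'⟩
          exact ⟨_, hy, e.right_inv hy'⟩
        · rintro ⟨p, hp, rfl⟩
          exact ⟨by simpa [e.left_inv (hsub hp)] using hp, e.map_source (hsub hp)⟩
      have hcont : ContinuousOn (fun y => Real.sqrt (metricMatrix n c y).det) (e '' K') :=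
        Real.continuous_sqrt.comp_continuousOn
          ((continuous_id.matrix_det).comp_continuousOn ((continuousOn_metricMatrix c).mono hKt))
      obtain ⟨C, hC⟩ := hKe.exists_bound_of_continuousOn hcont
      rw [Measure.map_apply_of_aemeasurable hae hK'.measurableSet, withDensity_apply',
        Measure.restrict_restrict' e.open_target.measurableSet, heq]
      calc ∫⁻ y in e '' K', ENNReal.ofReal (Real.sqrt (metricMatrix n c y).det)
          ≤ ∫⁻ _ in e '' K', ENNReal.ofReal C :=
            setLIntegral_mono measurable_const fun y hy =>
              ENNReal.ofReal_le_ofReal ((le_abs_self _).trans (hC y hy))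
        _ = ENNReal.ofReal C * volume (e '' K') := by simp
        _ < ⊤ := ENNReal.mul_lt_top ENNReal.ofReal_lt_top hKe.measure_lt_top
    · rw [Measure.map_of_not_aemeasurable hae]
      simp
  · intro c hc
    rw [withDensity_apply _ hK.measurableSet]
    refine setLIntegral_eq_zero hK.measurableSet fun p hp => ?_
    simp only [Finite.mem_toFinset, mem_ofPred_eq, not_nonempty_iff_eq_empty] at hc
    have h0 : ρ c p = 0 := by
      by_contra h
      have : p ∈ Function.support (ρ c) ∩ K := ⟨h, hp⟩
      rwa [hc] at this
    simp [ρ, h0] at h0 ⊢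

/-- A measurable function (glued from coordinate functions) whose law under the Riemannian volume
is absolutely continuous. -/
lemma exists_measurable_map_riemVol_absolutelyContinuous (hn : 1 ≤ n) [SecondCountableTopology M]
    [IsManifold (𝓡 n) ∞ M] :
    ∃ X : M → ℝ, Measurable X ∧ (riemVol n M).map X ≪ volume := by
  rcases isEmpty_or_nonempty M with hM | hM
  · refine ⟨fun _ => 0, measurable_const, ?_⟩
    have : riemVol n M = 0 := Measure.eq_zero_of_isEmpty _
    rw [this, Measure.map_zero]
    exact Measure.AbsolutelyContinuous.zero _
  obtain ⟨s, hs, hsU⟩ := TopologicalSpace.countable_cover_nhds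
    (fun x : M => chart_source_mem_nhds (EuclideanSpace ℝ (Fin n)) x)
  have hne : s.Nonempty := by
    by_contra h
    rw [not_nonempty_iff_eq_empty] at h
    simp [h] at hsU
    exact empty_ne_univ hsU
  obtain ⟨c, rfl⟩ := hs.exists_eq_range hne
  set e := fun i => chartAt (EuclideanSpace ℝ (Fin n)) (c i)
  set i₀ : Fin n := ⟨0, hn⟩
  -- `X` is the first coordinate of one of countably many charts, chosen by disjointifying their
  -- domains. The preimage of a null set is covered by chart preimages of null cylinders.
  set g : ℕ → M → ℝ := fun i => (e i).source.indicator fun x => e i x i₀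
  have hopen : ∀ i, MeasurableSet (e i).source := fun i => (e i).open_source.measurableSet
  have hg : ∀ i, Measurable (g i) := by
    intro i
    refine measurable_of_restrict_of_restrict_compl (hopen i) ?_ ?_
    · have : (e i).source.domRestrict (g i) = (e i).source.domRestrict fun x => e i x i₀ := by
        ext x; simp [g]
      rw [this]
      exact (continuousOn_iff_continuous_domRestrict.1 ((EuclideanSpace.proj i₀).continuous.comp_continuousOn
        (e i).continuousOn)).measurable
    · have : (e i).sourceᶜ.domRestrict (g i) = fun _ => 0 := by
        ext x
        exact indicator_of_notMem (s := (e i).source) x.2 fun x => e i x i₀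
      rw [this]
      exact measurable_const
  obtain ⟨X, hX, hXg⟩ := exists_measurable_piecewise (disjointed fun i => (e i).source)
    (fun i => MeasurableSet.disjointed hopen i) g hg (fun i j hij x hx =>
      absurd hx.2 (disjoint_left.1 (disjoint_disjointed _ hij) hx.1))
  refine ⟨X, hX, Measure.AbsolutelyContinuous.mk fun Z hZ h0 => ?_⟩
  rw [Measure.map_apply hX hZ]
  have hZ0 : volume {y : EuclideanSpace ℝ (Fin n) | y i₀ ∈ Z} = 0 := by
    have h1 := (Measure.quasiMeasurePreserving_eval (fun _ : Fin n => (volume : Measure ℝ)) i₀).comp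
      (PiLp.volume_preserving_ofLp (Fin n)).quasiMeasurePreserving
    exact h1.preimage_null h0
  have hsub : X ⁻¹' Z ⊆ ⋃ i, ((e i).source ∩ e i ⁻¹' {y | y i₀ ∈ Z}) := by
    intro x hx
    have hxU : x ∈ ⋃ i, disjointed (fun i => (e i).source) i := by
      rw [iUnion_disjointed, ← biUnion_range (f := c)
        (g := fun y => (chartAt (EuclideanSpace ℝ (Fin n)) y).source), hsU]
      trivial
    obtain ⟨i, hi⟩ := mem_iUnion.1 hxU
    have his := disjointed_subset _ _ hi
    refine mem_iUnion.2 ⟨i, his, ?_⟩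
    have := hXg i hi
    simp only [g, indicator_of_mem his] at this
    simpa [mem_preimage, this] using hx
  exact measure_mono_null hsub
    (measure_iUnion_null fun i => riemVol_chart_preimage_null (c i) hZ0)

/-- Either a set can be enlarged, inside an open set `U`, to have exactly the measure `τ`, or
a neighbourhood of a given point can be added to it without exceeding `τ`. -/
lemma exists_chart_ball_enlarging (hn : 1 ≤ n) [IsManifold (𝓡 n) ∞ M] {U : Set M} (hU : IsOpen U)
    (hUfin : riemVol n M U ≠ ⊤) {x : M} (hx : x ∈ U) :
    ∃ W ∈ 𝓝 x, W ⊆ U ∧ IsClosed W ∧ riemVol n M (frontier W) = 0 ∧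
      ∀ S ⊆ U, MeasurableSet S → ∀ τ : ℝ, (riemVol n M).real S ≤ τ →
        τ ≤ (riemVol n M).real (S ∪ W) →
        ∃ V ⊆ U, IsClosed V ∧ riemVol n M (frontier V) = 0 ∧
          (riemVol n M).real (S ∪ V) = τ := by
  have : Nonempty (Fin n) := ⟨⟨0, hn⟩⟩
  set e := chartAt (EuclideanSpace ℝ (Fin n)) x
  have hxe : x ∈ e.source := mem_chart_source _ x
  have hopen : IsOpen (e.target ∩ e.symm ⁻¹' U) := e.isOpen_inter_preimage_symm hU
  obtain ⟨r, hr, hball⟩ := Metric.nhds_basis_closedBall.mem_iff.1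
    (hopen.mem_nhds (show e x ∈ e.target ∩ e.symm ⁻¹' U from
      ⟨e.map_source hxe, by simpa [e.left_inv hxe] using hx⟩))
  set D : ℝ → Set M := fun t => e.symm '' Metric.closedBall (e x) t
  have hbt : ∀ t ≤ r, Metric.closedBall (e x) t ⊆ e.target := fun t ht =>
    (Metric.closedBall_subset_closedBall ht).trans (hball.trans inter_subset_left)
  have hDmem : ∀ t ≤ r, ∀ p, p ∈ D t ↔ p ∈ e.source ∧ dist (e p) (e x) ≤ t := by
    intro t ht p
    constructor
    · rintro ⟨y, hy, rfl⟩
      exact ⟨e.map_target (hbt t ht hy), by simpa [e.right_inv (hbt t ht hy)] using hy⟩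
    · rintro ⟨hp, hd⟩
      exact ⟨e p, hd, e.left_inv hp⟩
  have hDU : ∀ t ≤ r, D t ⊆ U := by
    rintro t ht _ ⟨y, hy, rfl⟩
    exact (hball (Metric.closedBall_subset_closedBall ht hy)).2
  have hDc : ∀ t ≤ r, IsClosed (D t) := fun t ht =>
    ((isCompact_closedBall (e x) t).image_of_continuousOn
      (e.continuousOn_symm.mono (hbt t ht))).isClosed
  have hint : ∀ t ≤ r, ∀ p ∈ e.source, dist (e p) (e x) < t → D t ∈ 𝓝 p := by
    intro t ht p hp hd
    have h1 : ∀ᶠ q in 𝓝 p, dist (e q) (e x) < t :=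
      (((e.continuousAt hp).dist continuousAt_const).eventually_lt_const hd)
    filter_upwards [h1, e.open_source.mem_nhds hp] with q hq hqs
    exact (hDmem t ht q).2 ⟨hqs, hq.le⟩
  -- In positive dimension even the sphere of radius 0 is null, which is needed for the endpoint t =
  -- 0 below.
  have hsph : ∀ t ≤ r, riemVol n M {p | p ∈ e.source ∧ dist (e p) (e x) = t} = 0 := fun t ht =>
    riemVol_chart_preimage_null x (Measure.addHaar_sphere volume (e x) t)
  have hDf : ∀ t ≤ r, riemVol n M (frontier (D t)) = 0 := by
    intro t ht
    refine measure_mono_null ?_ (hsph t ht)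
    rw [(hDc t ht).frontier_eq]
    rintro p ⟨hp, hpi⟩
    obtain ⟨hps, hpd⟩ := (hDmem t ht p).1 hp
    exact ⟨hps, hpd.eq_of_not_lt fun h => hpi (mem_interior_iff_mem_nhds.2 (hint t ht p hps h))⟩
  refine ⟨D r, hint r le_rfl x hxe (by simpa using hr), hDU r le_rfl, hDc r le_rfl, hDf r le_rfl,
    fun S hSU hS τ hτ0 hτ1 => ?_⟩
  set μ := (riemVol n M).restrict U
  have : IsFiniteMeasure μ := ⟨by simpa [μ] using hUfin.lt_top⟩
  have hμ : ∀ t ≤ r, ∫ p, (S ∪ D t).indicator (1 : M → ℝ) p ∂μ = (riemVol n M).real (S ∪ D t) := by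
    intro t ht
    rw [integral_indicator_one (hS.union (hDc t ht).measurableSet), measureReal_def,
      Measure.restrict_apply (hS.union (hDc t ht).measurableSet),
      inter_eq_left.2 (union_subset hSU (hDU t ht)), measureReal_def]
  -- Off the null sphere of radius t, membership in `D s` is constant for s near t, so dominated
  -- convergence applies. The intermediate value theorem then yields a radius with measure exactly
  -- τ.
  have hcont : ContinuousOn (fun t => ∫ p, (S ∪ D t).indicator (1 : M → ℝ) p ∂μ) (Icc 0 r) := by
    intro t ht
    refine continuousWithinAt_of_dominated (bound := fun _ => 1) ?_ ?_ (integrable_const _) ?_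
    · filter_upwards [self_mem_nhdsWithin] with s hs
      exact (measurable_one.indicator
        (hS.union (hDc s hs.2).measurableSet)).aestronglyMeasurable
    · exact Eventually.of_forall fun s => ae_of_all _ fun p =>
        (norm_indicator_le_norm_self _ _).trans (by simp)
    · have hne : ∀ᵐ p ∂μ, ¬ (p ∈ e.source ∧ dist (e p) (e x) = t) :=
        ae_restrict_of_ae (measure_eq_zero_iff_ae_notMem.1 (hsph t ht.2))
      filter_upwards [hne] with p hp
      have hev : ∀ᶠ s in 𝓝[Icc 0 r] t, (p ∈ D s ↔ p ∈ D t) := by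
        by_cases hps : p ∈ e.source
        · have hpt : dist (e p) (e x) ≠ t := fun h => hp ⟨hps, h⟩
          rcases hpt.lt_or_gt with h | h
          · filter_upwards [self_mem_nhdsWithin, nhdsWithin_le_nhds (lt_mem_nhds h)] with s hs hs'
            rw [hDmem s hs.2, hDmem t ht.2]
            simp [hps, h.le, (show _ < s from hs').le]
          · filter_upwards [self_mem_nhdsWithin, nhdsWithin_le_nhds (gt_mem_nhds h)] with s hs hs'
            rw [hDmem s hs.2, hDmem t ht.2]
            simp [hps, h.not_ge, (show s < _ from hs').not_ge]
        · filter_upwards [self_mem_nhdsWithin] with s hs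
          rw [hDmem s hs.2, hDmem t ht.2]
          simp [hps]
      refine (continuousWithinAt_const (b := (S ∪ D t).indicator (1 : M → ℝ) p)).congr_of_eventuallyEq
        ?_ rfl
      filter_upwards [hev] with s hs
      have hst : p ∈ S ∪ D s ↔ p ∈ S ∪ D t := or_congr Iff.rfl hs
      by_cases h : p ∈ S ∪ D t
      · rw [indicator_of_mem h, indicator_of_mem (hst.2 h)]
      · rw [indicator_of_notMem h, indicator_of_notMem (mt hst.1 h)]
  have h0 : (riemVol n M).real (S ∪ D 0) ≤ τ := by
    have hD0 : riemVol n M (D 0) = 0 := by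
      refine measure_mono_null (fun p hp => ?_) (hsph 0 hr.le)
      obtain ⟨h1, h2⟩ := (hDmem 0 hr.le p).1 hp
      exact ⟨h1, le_antisymm h2 dist_nonneg⟩
    rwa [measureReal_def, measure_congr (union_ae_eq_left_of_ae_eq_empty (ae_eq_empty.2 hD0))]
  obtain ⟨t, ht, htτ⟩ := intermediate_value_Icc hr.le hcont
    (show τ ∈ Icc _ _ from ⟨by rwa [hμ 0 hr.le], by rwa [hμ r le_rfl]⟩)
  exact ⟨D t, hDU t ht.2, hDc t ht.2, hDf t ht.2, by rw [← hμ t ht.2]; exact htτ⟩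

end Charts

/-! ### Uniform integrability of the squares -/

section UniformIntegrability

variable {α : Type*} [MeasurableSpace α]

/-- A bound in `L^{2p}`, `p > 1`, makes the squares uniformly integrable. -/
lemma exists_pos_forall_lintegral_sq_le_of_eLpNorm_le {ι : Type*} {μ : Measure α} {φ : ι → α → ℝ}
    (hφ : ∀ j, AEStronglyMeasurable (φ j) μ) {p : ℝ≥0∞} (hp : 1 < p) {A : ℝ} (hA : 0 < A)
    (hbd : ∀ j, eLpNorm (φ j) (2 * p) μ ≤ ENNReal.ofReal A) {ε : ℝ} (hε : 0 < ε) :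
    ∃ δ > 0, ∀ E : Set α, μ E ≤ ENNReal.ofReal δ →
      ∀ j, ∫⁻ x in E, ENNReal.ofReal (φ j x ^ 2) ∂μ ≤ ENNReal.ofReal ε := by
  -- The Hölder exponent 1/2 - 1/(2p). For p = ∞ the conventions `⊤.toReal = 0` and 1/0 = 0 give the
  -- correct value 1/2.
  set s : ℝ := 1 / (2 : ℝ≥0∞).toReal - 1 / (2 * p).toReal with hs_def
  have hs : 0 < s := by
    rw [hs_def, sub_pos]
    by_cases htop : p = ⊤
    · simp [htop]
    · have h1 : 1 < p.toReal := by
        rw [← ENNReal.toReal_one]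
        exact (ENNReal.toReal_lt_toReal ENNReal.one_ne_top htop).2 hp
      rw [ENNReal.toReal_mul, ENNReal.toReal_ofNat]
      exact one_div_lt_one_div_of_lt (by norm_num) (by linarith)
  have h2p : (2 : ℝ≥0∞) ≤ 2 * p := le_mul_of_one_le_right (by positivity) hp.le
  have hB : 0 < Real.sqrt ε / A := by positivity
  -- This δ solves A δ^s = √ε.
  refine ⟨(Real.sqrt ε / A) ^ (1 / s), by positivity, fun E hE j => ?_⟩
  have h1 : eLpNorm (φ j) 2 (μ.restrict E) ≤ ENNReal.ofReal (Real.sqrt ε) := by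
    calc eLpNorm (φ j) 2 (μ.restrict E)
        ≤ eLpNorm (φ j) (2 * p) (μ.restrict E) * μ.restrict E univ ^ s :=
          eLpNorm_le_eLpNorm_mul_rpow_measure_univ h2p (hφ j).restrict
      _ ≤ ENNReal.ofReal A * ENNReal.ofReal ((Real.sqrt ε / A) ^ (1 / s)) ^ s := by
          gcongr
          · exact (eLpNorm_mono_measure _ Measure.restrict_le_self).trans (hbd j)
          · simpa using hE
      _ = ENNReal.ofReal (Real.sqrt ε) := by
          rw [ENNReal.ofReal_rpow_of_nonneg (by positivity) hs.le, ← Real.rpow_mul hB.le,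
            one_div_mul_cancel hs.ne', Real.rpow_one, ← ENNReal.ofReal_mul hA.le,
            mul_div_cancel₀ _ hA.ne']
  have h2 : ∫⁻ x in E, ENNReal.ofReal (φ j x ^ 2) ∂μ = eLpNorm (φ j) 2 (μ.restrict E) ^ 2 := by
    have := eLpNorm_nnreal_pow_eq_lintegral (p := 2) (f := φ j) (μ := μ.restrict E) (by norm_num)
    simp only [NNReal.coe_ofNat, ENNReal.coe_ofNat, ENNReal.rpow_ofNat] at this
    rw [this]
    refine lintegral_congr fun x => ?_
    rw [← ofReal_norm, ← ENNReal.ofReal_pow (norm_nonneg _), Real.norm_eq_abs, sq_abs]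
  rw [h2]
  calc eLpNorm (φ j) 2 (μ.restrict E) ^ 2 ≤ ENNReal.ofReal (Real.sqrt ε) ^ 2 := by gcongr
    _ = ENNReal.ofReal ε := by
        rw [← ENNReal.ofReal_pow (Real.sqrt_nonneg _), Real.sq_sqrt hε.le]

end UniformIntegrability

/-! ### From vague to setwise convergence -/

section Setwise

variable {M : Type*} [EMetricSpace M] [LocallyCompactSpace M] [SecondCountableTopology M]
  [MeasurableSpace M] [BorelSpace M]

omit [LocallyCompactSpace M] in
/-- A compact set has open neighbourhoods of almost the same measure in any open set. -/
lemma exists_isOpen_superset_subset_measureReal_sdiff_lt (ν : Measure M) [IsFiniteMeasure ν]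
    {F Ω : Set M} (hF : IsCompact F) (hFΩ : F ⊆ Ω) (hΩ : IsOpen Ω) {δ : ℝ} (hδ : 0 < δ) :
    ∃ U, IsOpen U ∧ F ⊆ U ∧ U ⊆ Ω ∧ ν.real (U \ F) < δ := by
  obtain ⟨U, hFU, hU, hlt⟩ := F.exists_isOpen_lt_add (μ := ν) (measure_ne_top _ _)
    (ε := ENNReal.ofReal δ) (by simpa using hδ)
  refine ⟨U ∩ Ω, hU.inter hΩ, subset_inter hFU hFΩ, inter_subset_right, ?_⟩
  refine (measureReal_mono (sdiff_subset_sdiff_left inter_subset_left)).trans_lt ?_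
  rw [measureReal_def, measure_sdiff hFU hF.measurableSet.nullMeasurableSet (measure_ne_top _ _)]
  refine (ENNReal.toReal_lt_toReal (by finiteness) ENNReal.ofReal_ne_top).2
    (ENNReal.sub_lt_of_lt_add (measure_mono hFU) (by rwa [add_comm])) |>.trans_eq
    (ENNReal.toReal_ofReal hδ.le)

/-- A measurable set contains compact subsets of almost the same measure. -/
lemma exists_isCompact_subset_measureReal_sdiff_lt (ν : Measure M) [IsFiniteMeasure ν]
    {E : Set M} (hE : MeasurableSet E) {δ : ℝ} (hδ : 0 < δ) :
    ∃ F ⊆ E, IsCompact F ∧ ν.real (E \ F) < δ := by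
  obtain ⟨F, hFE, hF, hlt⟩ := hE.exists_isCompact_sdiff_lt (μ := ν) (measure_ne_top _ _)
    (ε := ENNReal.ofReal δ) (by simpa using hδ)
  exact ⟨F, hFE, hF, by
    rw [measureReal_def]
    exact ((ENNReal.toReal_lt_toReal (by finiteness) ENNReal.ofReal_ne_top).2 hlt).trans_eq
      (ENNReal.toReal_ofReal hδ.le)⟩

/-- Vague convergence on an open set of full measure of a uniformly integrable sequence implies
setwise convergence. -/
lemma tendsto_measureReal_of_vague {ν : ℕ → Measure M} {ν' : Measure M}
    [∀ j, IsProbabilityMeasure (ν j)] [IsProbabilityMeasure ν'] {Ω : Set M} (hΩ : IsOpen Ω)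
    (hΩ0 : ν' Ωᶜ = 0)
    (hvague : ∀ f : M → ℝ, Continuous f → HasCompactSupport f → tsupport f ⊆ Ω →
      Tendsto (fun j => ∫ p, f p ∂(ν j)) atTop (𝓝 (∫ p, f p ∂ν')))
    (hUI : ∀ ε > 0, ∃ δ > 0, ∀ E, MeasurableSet E → ν'.real E < δ → ∀ j, (ν j).real E ≤ ε)
    {E : Set M} (hE : MeasurableSet E) :
    Tendsto (fun j => (ν j).real E) atTop (𝓝 (ν'.real E)) := by
  rw [Metric.tendsto_atTop]
  intro ε hε
  obtain ⟨δ, hδ, hδU⟩ := hUI (ε / 8) (by positivity)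
  set δ' := min δ (ε / 8)
  have hδ' : 0 < δ' := by positivity
  obtain ⟨F, hFE, hF, hF1⟩ :=
    exists_isCompact_subset_measureReal_sdiff_lt ν' (hE.inter hΩ.measurableSet) hδ'
  obtain ⟨U, hU, hFU, hUΩ, hU1⟩ := exists_isOpen_superset_subset_measureReal_sdiff_lt ν' hF
    (hFE.trans inter_subset_right) hΩ hδ'
  obtain ⟨k, hk, hkc, hFk, hkU⟩ := exists_compact_closed_between hF hU hFU
  obtain ⟨g, hg1, hg0, hgc, hg01⟩ := exists_continuous_one_zero_of_isCompact hF
    (isOpen_interior (s := k)).isClosed_compl (disjoint_compl_right_iff_subset.2 hFk)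
  have hsupp : tsupport g ⊆ k := closure_minimal (fun x hx => by
    by_contra h
    exact hx (hg0 fun h' => h (interior_subset h'))) hkc
  have hEF : ν'.real (E \ F) < δ' := by
    have h1 : E \ F ⊆ (E ∩ Ω) \ F ∪ Ωᶜ := fun x hx => by
      by_cases h : x ∈ Ω
      · exact Or.inl ⟨⟨hx.1, h⟩, hx.2⟩
      · exact Or.inr h
    have h2 := (measureReal_mono (μ := ν') h1).trans (measureReal_union_le _ _)
    have h3 : ν'.real Ωᶜ = 0 := by rw [measureReal_def, hΩ0, ENNReal.toReal_zero]
    linarith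
  have hmF := hF.measurableSet
  -- Since 1_F ≤ g ≤ 1_U and F ⊆ E, only `E \ F` and `U \ F` contribute to the error. They are small
  -- for ν', hence for all ν_j by uniform absolute continuity.
  have approx : ∀ (ρ : Measure M) [IsProbabilityMeasure ρ],
      |ρ.real E - ∫ p, g p ∂ρ| ≤ ρ.real (E \ F) + ρ.real (U \ F) := by
    intro ρ _
    have hgi : Integrable g ρ := g.continuous.integrable_of_hasCompactSupport hgc
    have hFi : Integrable (F.indicator (1 : M → ℝ)) ρ := (integrable_const 1).indicator hmF
    have hUi : Integrable (U.indicator (1 : M → ℝ)) ρ :=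
      (integrable_const 1).indicator hU.measurableSet
    have hlo : ρ.real F ≤ ∫ p, g p ∂ρ := by
      rw [← integral_indicator_one hmF]
      refine integral_mono hFi hgi fun x => ?_
      by_cases hx : x ∈ F
      · simp [hx, hg1 hx]
      · simp [hx, (hg01 x).1]
    have hhi : ∫ p, g p ∂ρ ≤ ρ.real U := by
      rw [← integral_indicator_one hU.measurableSet]
      refine integral_mono hgi hUi fun x => ?_
      by_cases hx : x ∈ U
      · simp [hx, (hg01 x).2]
      · have : x ∈ (interior k)ᶜ := fun h => hx (hkU (interior_subset h))
        simp [hx, hg0 this]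
    have h1 := measureReal_sdiff_add_inter (μ := ρ) (s := E) hmF
    have h2 := measureReal_sdiff_add_inter (μ := ρ) (s := U) hmF
    rw [inter_eq_right.2 (hFE.trans inter_subset_left)] at h1
    rw [inter_eq_right.2 hFU] at h2
    have h3 : 0 ≤ ρ.real (E \ F) := measureReal_nonneg
    have h4 : 0 ≤ ρ.real (U \ F) := measureReal_nonneg
    rw [abs_le]
    constructor <;> linarith
  obtain ⟨N, hN⟩ := Metric.tendsto_atTop.1
    (hvague g g.continuous hgc (hsupp.trans (hkU.trans hUΩ))) (ε / 8) (by positivity)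
  refine ⟨N, fun j hj => ?_⟩
  have h1 := approx (ν j)
  have h2 := approx ν'
  have h3 := hN j hj
  have h4 := hδU _ (hE.diff hmF) (hEF.trans_le (min_le_left _ _)) j
  have h5 := hδU _ (hU.measurableSet.diff hmF) (hU1.trans_le (min_le_left _ _)) j
  have h6 : δ' ≤ ε / 8 := min_le_right _ _
  rw [Real.dist_eq] at h3 ⊢
  rw [abs_le] at h1 h2
  rw [abs_lt] at h3 ⊢
  constructor <;> linarith

end Setwise

/-! ### Jordan measurable sets of prescribed volume -/

section Jordan

variable {n : ℕ} {M : Type*} [EMetricSpace M] [ChartedSpace (EuclideanSpace ℝ (Fin n)) M]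
  [RiemannianBundle (fun x : M => TangentSpace (𝓡 n) x)] [MeasurableSpace M] [BorelSpace M]
  [IsManifold (𝓡 n) ∞ M]

omit [BorelSpace M] [IsManifold (𝓡 n) ∞ M] in
lemma riemVol_frontier_union_null {S T : Set M} (hS : riemVol n M (frontier S) = 0)
    (hT : riemVol n M (frontier T) = 0) : riemVol n M (frontier (S ∪ T)) = 0 :=
  measure_mono_null ((frontier_union_subset S T).trans
    (union_subset_union inter_subset_left inter_subset_right)) (measure_union_null hS hT)

/-- There is a closed Jordan measurable set between a compact set and an open set. -/
lemma exists_isClosed_null_frontier_between (hn : 1 ≤ n) {F U : Set M} (hF : IsCompact F)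
    (hU : IsOpen U) (hFU : F ⊆ U) (hUfin : riemVol n M U ≠ ⊤) :
    ∃ V, F ⊆ V ∧ V ⊆ U ∧ IsClosed V ∧ riemVol n M (frontier V) = 0 := by
  refine hF.induction_on
    (p := fun K => ∃ V, K ⊆ V ∧ V ⊆ U ∧ IsClosed V ∧ riemVol n M (frontier V) = 0) ?_ ?_ ?_ ?_
  · exact ⟨∅, by simp⟩
  · rintro K K' hKK' ⟨V, hV, h⟩
    exact ⟨V, hKK'.trans hV, h⟩
  · rintro K K' ⟨V, hKV, hVU, hVc, hV0⟩ ⟨V', hKV', hVU', hVc', hV0'⟩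
    exact ⟨V ∪ V', union_subset_union hKV hKV', union_subset hVU hVU', hVc.union hVc',
      riemVol_frontier_union_null hV0 hV0'⟩
  · intro x hx
    obtain ⟨W, hW, hWU, hWc, hW0, -⟩ := exists_chart_ball_enlarging hn hU hUfin (hFU hx)
    exact ⟨W, nhdsWithin_le_nhds hW, W, Subset.rfl, hWU, hWc, hW0⟩

/-- A closed Jordan measurable set can be enlarged inside an open set to have a prescribed
measure. -/
lemma exists_superset_null_frontier_measureReal_eq (hn : 1 ≤ n) [SecondCountableTopology M]
    {S U : Set M} (hU : IsOpen U) (hUfin : riemVol n M U ≠ ⊤) (hSU : S ⊆ U) (hS : IsClosed S)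
    (hS0 : riemVol n M (frontier S) = 0) {τ : ℝ} (hSτ : (riemVol n M).real S ≤ τ)
    (hτ : τ < (riemVol n M).real U) :
    ∃ V, S ⊆ V ∧ V ⊆ U ∧ IsClosed V ∧ riemVol n M (frontier V) = 0 ∧
      (riemVol n M).real V = τ := by
  have : LocallyCompactSpace M := ChartedSpace.locallyCompactSpace (EuclideanSpace ℝ (Fin n)) M
  -- If no admissible set has measure exactly τ, adding a ball can never carry the measure past τ.
  -- Finitely many balls cover a compact `K` of measure greater than τ, a contradiction.
  by_contra! hcon
  set μ := (riemVol n M).restrict U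
  have : IsFiniteMeasure μ := ⟨by simpa [μ] using hUfin.lt_top⟩
  obtain ⟨K, hKU, hK, hKlt⟩ := exists_isCompact_subset_measureReal_sdiff_lt μ hU.measurableSet
    (sub_pos.2 hτ)
  have hμ : ∀ T ⊆ U, μ.real T = (riemVol n M).real T := fun T hT => by
    rw [measureReal_def, Measure.restrict_eq_self _ hT, measureReal_def]
  have hKτ : τ < (riemVol n M).real K := by
    have h1 := measureReal_sdiff_add_inter (μ := μ) (s := U) hK.measurableSet
    rw [inter_eq_right.2 hKU, hμ U Subset.rfl, hμ K hKU] at h1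
    linarith
  have key : ∀ T, S ⊆ T → T ⊆ U → IsClosed T → riemVol n M (frontier T) = 0 →
      (riemVol n M).real T ≤ τ → ∃ V, T ∪ K ⊆ V ∧ V ⊆ U ∧ IsClosed V ∧
        riemVol n M (frontier V) = 0 ∧ (riemVol n M).real V ≤ τ := by
    -- Quantifying over `T` lets the union step process the second piece starting from the set built
    -- for the first.
    refine hK.induction_on (p := fun K => ∀ T, S ⊆ T → T ⊆ U → IsClosed T →
      riemVol n M (frontier T) = 0 → (riemVol n M).real T ≤ τ → ∃ V, T ∪ K ⊆ V ∧ V ⊆ U ∧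
        IsClosed V ∧ riemVol n M (frontier V) = 0 ∧ (riemVol n M).real V ≤ τ) ?_ ?_ ?_ ?_
    · intro T _ h1 h2 h3 h4
      exact ⟨T, by simp, h1, h2, h3, h4⟩
    · intro K K' hKK' h T h0 h1 h2 h3 h4
      obtain ⟨V, hV, h⟩ := h T h0 h1 h2 h3 h4
      exact ⟨V, (union_subset_union_right T hKK').trans hV, h⟩
    · intro K K' h h' T h0 h1 h2 h3 h4
      obtain ⟨V, hV, hV1, hV2, hV3, hV4⟩ := h T h0 h1 h2 h3 h4
      obtain ⟨V', hV', h⟩ :=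
        h' V (h0.trans (subset_union_left.trans hV)) hV1 hV2 hV3 hV4
      refine ⟨V', ?_, h⟩
      rw [← union_assoc]
      exact (union_subset_union_left K' hV).trans hV'
    · intro x hx
      obtain ⟨W, hW, hWU, hWc, hW0, hWτ⟩ := exists_chart_ball_enlarging hn hU hUfin (hKU hx)
      refine ⟨W, nhdsWithin_le_nhds hW, fun T h0 h1 h2 h3 h4 => ⟨T ∪ W, Subset.rfl,
        union_subset h1 hWU, h2.union hWc, riemVol_frontier_union_null h3 hW0, ?_⟩⟩
      by_contra! hlt
      obtain ⟨V, hVU, hVc, hV0, hVτ⟩ := hWτ T h1 h2.measurableSet τ h4 hlt.le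
      exact hcon (T ∪ V) (h0.trans subset_union_left) (union_subset h1 hVU) (h2.union hVc)
        (riemVol_frontier_union_null h3 hV0) hVτ
  obtain ⟨V, hV, hVU, -, -, hVτ⟩ := key S Subset.rfl hSU hS hS0 hSτ
  have := measureReal_mono (μ := riemVol n M) (subset_union_right.trans hV)
    (measure_ne_top_of_subset hVU hUfin)
  linarith

end Jordan

/-! ### The probability measures with density u² -/

section SquareDensity

variable {α : Type*} [MeasurableSpace α] {μ : Measure α} {u : α → ℝ}

lemma isProbabilityMeasure_withDensity_sq (hu : MemLp u 2 μ) (h1 : ∫ x, u x ^ 2 ∂μ = 1) :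
    IsProbabilityMeasure (μ.withDensity fun x => ENNReal.ofReal (u x ^ 2)) := by
  refine ⟨?_⟩
  rw [withDensity_apply _ MeasurableSet.univ, Measure.restrict_univ,
    ← ofReal_integral_eq_lintegral_ofReal hu.integrable_sq (ae_of_all _ fun x => sq_nonneg _), h1,
    ENNReal.ofReal_one]

lemma measureReal_withDensity_sq [SFinite μ] (hu : AEStronglyMeasurable u μ) (E : Set α) :
    (μ.withDensity fun x => ENNReal.ofReal (u x ^ 2)).real E = ∫ x in E, u x ^ 2 ∂μ := by
  rw [measureReal_def, withDensity_apply', integral_eq_lintegral_of_nonneg_ae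
    (ae_of_all _ fun x => sq_nonneg _) (hu.restrict.pow 2)]

lemma integral_withDensity_sq (hu : AEStronglyMeasurable u μ) (f : α → ℝ) :
    ∫ x, f x ∂(μ.withDensity fun x => ENNReal.ofReal (u x ^ 2)) = ∫ x, f x * u x ^ 2 ∂μ := by
  rw [integral_withDensity_eq_integral_toReal_smul₀ (hu.aemeasurable.pow_const 2).ennreal_ofReal
    (ae_of_all _ fun x => ENNReal.ofReal_lt_top)]
  refine integral_congr_ae (ae_of_all _ fun x => ?_)
  simp only [ENNReal.toReal_ofReal (sq_nonneg (u x)), smul_eq_mul, mul_comm]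

end SquareDensity

/-! ### Regularization of the set and conclusion -/

/-- Jordan measurable sets catching almost the proportion `L` of every `φ j` at once. -/
lemma exists_mem_jordanSets_forall_le {n : ℕ} (hn : 1 ≤ n) {M : Type*} [EMetricSpace M]
    [SecondCountableTopology M] [ChartedSpace (EuclideanSpace ℝ (Fin n)) M]
    [IsManifold (𝓡 n) ∞ M] [RiemannianBundle (fun x : M => TangentSpace (𝓡 n) x)]
    [MeasurableSpace M] [BorelSpace M] {Ω : Set M} (hΩ : IsOpen Ω)
    (hfin : riemVol n M Ω ≠ ⊤) (hpos : riemVol n M Ω ≠ 0)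
    {ν : ℕ → Measure M} [∀ j, IsProbabilityMeasure (ν j)]
    (hset : ∀ E, MeasurableSet E → Tendsto (fun j => (ν j).real E) atTop
      (𝓝 ((ProbabilityTheory.cond (riemVol n M) Ω).real E)))
    (hUI : ∀ ε > 0, ∃ δ > 0, ∀ E, MeasurableSet E →
      (ProbabilityTheory.cond (riemVol n M) Ω).real E < δ → ∀ j, (ν j).real E ≤ ε)
    {L : ℝ} (hL : L ∈ Ioo (0 : ℝ) 1) {c : ℝ} (hc : c < L) :
    ∃ S ∈ JordanSets n Ω L, ∀ j, c ≤ (ν j).real S := by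
  have : LocallyCompactSpace M := ChartedSpace.locallyCompactSpace (EuclideanSpace ℝ (Fin n)) M
  set ν' := ProbabilityTheory.cond (riemVol n M) Ω with hν'
  have hprob : IsProbabilityMeasure ν' :=
    ProbabilityTheory.cond_isProbabilityMeasure_of_finite hpos hfin
  have hm : 0 < (riemVol n M).real Ω := ENNReal.toReal_pos hpos hfin
  have hΩm := hΩ.measurableSet
  have hν'val : ∀ T ⊆ Ω, ν'.real T = (riemVol n M).real T / (riemVol n M).real Ω := by
    intro T hT
    rw [measureReal_def, hν', ProbabilityTheory.cond_apply hΩm, inter_eq_right.2 hT,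
      ENNReal.toReal_mul, ENNReal.toReal_inv, div_eq_inv_mul]
    rfl
  obtain ⟨X, hX, hXac⟩ := exists_measurable_map_riemVol_absolutelyContinuous (M := M) hn
  have hXac' : ν'.map X ≪ volume :=
    (ProbabilityTheory.cond_absolutelyContinuous.map hX).trans hXac
  -- Aiming at L - 2ε leaves room on both sides: ν'(S) ≤ L - ε, so the open neighbourhood of `F`
  -- still has ν'-measure at most L, while ν_j(F) ≥ L - 4ε ≥ c. The bound 4ε ≤ L keeps the target
  -- nonnegative.
  set ε := min (L - c) L / 4
  have hε : 0 < ε := by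
    have := hL.1
    have := sub_pos.2 hc
    positivity
  have hεc : 4 * ε ≤ L - c := by
    have : ε = min (L - c) L / 4 := rfl
    linarith [min_le_left (L - c) L]
  have hεL : 4 * ε ≤ L := by
    have : ε = min (L - c) L / 4 := rfl
    linarith [min_le_right (L - c) L]
  obtain ⟨S, hS, hSε⟩ := exists_measurableSet_forall_abs_measureReal_sub_le hset hUI hX hXac'
    (L := L - 2 * ε) (by linarith) (by linarith [hL.2]) hε
  have hS' : ν'.real S ≤ L - ε := by
    refine le_of_tendsto' (hset S hS) fun j => ?_
    linarith [(abs_le.1 (hSε j)).2]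
  obtain ⟨δ, hδ, hδU⟩ := hUI ε hε
  obtain ⟨F, hFS, hF, hFδ⟩ :=
    exists_isCompact_subset_measureReal_sdiff_lt ν' (hS.inter hΩm) hδ
  have hFΩ : F ⊆ Ω := hFS.trans inter_subset_right
  have hF' : ν'.real F ≤ L - ε := (measureReal_mono (hFS.trans inter_subset_left)).trans hS'
  have hνF : ∀ j, c ≤ (ν j).real F := by
    intro j
    have h1 := measureReal_sdiff_add_inter (μ := ν j) (s := S) hF.measurableSet
    rw [inter_eq_right.2 (hFS.trans inter_subset_left)] at h1
    have h0 : ν'.real (S \ F) < δ := by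
      refine lt_of_le_of_lt (le_of_eq ?_) hFδ
      refine measureReal_congr ?_
      filter_upwards [ProbabilityTheory.ae_cond_mem (μ := riemVol n M) hΩm] with x hx
      refine propext (show x ∈ S \ F ↔ x ∈ (S ∩ Ω) \ F from ?_)
      exact ⟨fun h => ⟨⟨h.1, hx⟩, h.2⟩, fun h => ⟨h.1.1, h.2⟩⟩
    have h2 := hδU (S \ F) (hS.diff hF.measurableSet) h0 j
    linarith [(abs_le.1 (hSε j)).1]
  obtain ⟨U, hU, hFU, hUΩ, hUε⟩ :=
    exists_isOpen_superset_subset_measureReal_sdiff_lt ν' hF hFΩ hΩ hε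
  have hUL : ν'.real U ≤ L := by
    have h1 := measureReal_sdiff_add_inter (μ := ν') (s := U) hF.measurableSet
    rw [inter_eq_right.2 hFU] at h1
    linarith
  obtain ⟨V, hFV, hVU, hVc, hV0⟩ := exists_isClosed_null_frontier_between hn hF hU hFU
    (measure_ne_top_of_subset hUΩ hfin)
  have hVΩ := hVU.trans hUΩ
  have hVL : (riemVol n M).real V ≤ L * (riemVol n M).real Ω := by
    have h1 : ν'.real V ≤ L := (measureReal_mono hVU).trans hUL
    rwa [hν'val V hVΩ, div_le_iff₀ hm] at h1
  obtain ⟨W, hVW, hWΩ, hWc, hW0, hWL⟩ := exists_superset_null_frontier_measureReal_eq hn hΩ hfin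
    hVΩ hVc hV0 hVL (by nlinarith [hL.2])
  refine ⟨W, ⟨hWΩ, hWc.measurableSet.nullMeasurableSet, ?_, hW0⟩, fun j =>
    (hνF j).trans (measureReal_mono (hFV.trans hVW))⟩
  rw [← ENNReal.ofReal_toReal (measure_ne_top_of_subset hWΩ hfin), ← ENNReal.ofReal_toReal hfin,
    ← ENNReal.ofReal_mul hL.1.le]
  exact congrArg ENNReal.ofReal hWL

theorem mainTheorem2 {n : ℕ} (hn : 1 ≤ n) {M : Type*} [EMetricSpace M]
    [SecondCountableTopology M] [ChartedSpace (EuclideanSpace ℝ (Fin n)) M]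
    [IsManifold (𝓡 n) ∞ M] [RiemannianBundle (fun x : M => TangentSpace (𝓡 n) x)]
    [IsContMDiffRiemannianBundle (𝓡 n) ∞ (EuclideanSpace ℝ (Fin n))
      (fun x : M => TangentSpace (𝓡 n) x)]
    [IsRiemannianManifold (𝓡 n) M] [MeasurableSpace M] [BorelSpace M]
    (Ω : Set M) (hΩo : IsOpen Ω) (hΩc : IsConnected Ω) (hΩb : IsCompact (closure Ω))
    (hΩL : HasLipschitzBoundary n Ω)
    (bc : BdryCond M) (hbc : bc.Admissible n Ω)
    (φ : ℕ → M → ℝ) (hφ : bc.IsEigenbasis n Ω φ)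
    (hQUE : QUE n Ω φ) (hLp : UniformLpBounded n Ω φ)
    (L : ℝ) (hL : L ∈ Ioo (0 : ℝ) 1) :
    IsLUB (J n φ '' JordanSets n Ω L) L := by
  have : LocallyCompactSpace M := ChartedSpace.locallyCompactSpace (EuclideanSpace ℝ (Fin n)) M
  have hfin : riemVol n M Ω ≠ ⊤ :=
    measure_ne_top_of_subset subset_closure (riemVol_lt_top_of_isCompact hΩb).ne
  have hΩm := hΩo.measurableSet
  set μ := (riemVol n M).restrict Ω with hμ
  have : IsFiniteMeasure μ := ⟨by simpa [μ] using hfin.lt_top⟩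
  have hmem : ∀ j, MemLp (φ j) 2 μ := fun j => by
    simpa using (hφ.inStateSpace j).1.re
  have hone : ∀ j, ∫ p, φ j p ^ 2 ∂μ = 1 := fun j => by
    simpa [pow_two] using hφ.orthonormal j j
  have hpos : riemVol n M Ω ≠ 0 := by
    intro h0
    have h1 := hone 0
    rw [hμ, Measure.restrict_eq_zero.2 h0, integral_zero_measure] at h1
    exact zero_ne_one h1
  have hm : 0 < (riemVol n M).real Ω := ENNReal.toReal_pos hpos hfin
  set ν : ℕ → Measure M := fun j => μ.withDensity fun x => ENNReal.ofReal (φ j x ^ 2) with hν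
  have hνp : ∀ j, IsProbabilityMeasure (ν j) := fun j =>
    isProbabilityMeasure_withDensity_sq (hmem j) (hone j)
  set ν' := ProbabilityTheory.cond (riemVol n M) Ω with hν'
  have hprob : IsProbabilityMeasure ν' :=
    ProbabilityTheory.cond_isProbabilityMeasure_of_finite hpos hfin
  have hUI : ∀ ε > 0, ∃ δ > 0, ∀ E, MeasurableSet E → ν'.real E < δ → ∀ j, (ν j).real E ≤ ε := by
    intro ε hε
    obtain ⟨p, hp, A, hA, hbd⟩ := hLp
    obtain ⟨δ, hδ, hδE⟩ := exists_pos_forall_lintegral_sq_le_of_eLpNorm_le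
      (fun j => (hmem j).aestronglyMeasurable) hp hA hbd hε
    refine ⟨δ / (riemVol n M).real Ω, by positivity, fun E hE hlt j => ?_⟩
    rw [lt_div_iff₀ hm, measureReal_def, hν', ProbabilityTheory.cond_apply hΩm, ENNReal.toReal_mul,
      ENNReal.toReal_inv, mul_comm, measureReal_def,
      mul_inv_cancel_left₀ (ENNReal.toReal_pos hpos hfin).ne', inter_comm,
      ← Measure.restrict_apply hE] at hlt
    have h1 := hδE E ((ENNReal.le_ofReal_iff_toReal_le (measure_ne_top μ E) hδ.le).2 hlt.le) j
    rw [measureReal_def, hν, withDensity_apply _ hE]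
    exact ENNReal.toReal_le_of_le_ofReal hε.le h1
  have hvague : ∀ f : M → ℝ, Continuous f → HasCompactSupport f → tsupport f ⊆ Ω →
      Tendsto (fun j => ∫ p, f p ∂(ν j)) atTop (𝓝 (∫ p, f p ∂ν')) := by
    intro f hf hfc hfs
    have h1 : ∫ p, f p ∂ν' = (∫ p in Ω, f p ∂(riemVol n M)) / (riemVol n M).real Ω := by
      rw [hν', ProbabilityTheory.cond, integral_smul_measure, ENNReal.toReal_inv, smul_eq_mul,
        div_eq_inv_mul]
      rfl
    rw [h1]
    exact (hQUE f hf hfc hfs).congr fun j =>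
      (integral_withDensity_sq (hmem j).aestronglyMeasurable f).symm
  have hset : ∀ E, MeasurableSet E → Tendsto (fun j => (ν j).real E) atTop (𝓝 (ν'.real E)) :=
    fun E hE => tendsto_measureReal_of_vague hΩo
      (by rw [hν', ProbabilityTheory.cond_apply hΩm]; simp) hvague hUI hE
  have hJ : ∀ S ⊆ Ω, ∀ j, ∫ p in S, φ j p ^ 2 ∂(riemVol n M) = (ν j).real S := by
    intro S hS j
    rw [hν, measureReal_withDensity_sq (hmem j).aestronglyMeasurable, hμ,
      Measure.restrict_restrict_of_subset hS]
  constructor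
  · rintro _ ⟨S, ⟨hSΩ, hSm, hSL, -⟩, rfl⟩
    -- `S` is only null measurable, so setwise convergence is applied to its measurable hull; ν_j
    -- and ν' do not see the difference.
    have hae := hSm.toMeasurable_ae_eq
    have hac : ∀ j, ν j ≪ riemVol n M := fun j =>
      (withDensity_absolutelyContinuous _ _).trans
        (Measure.absolutelyContinuous_of_le Measure.restrict_le_self)
    have hlim := hset _ (measurableSet_toMeasurable (riemVol n M) S)
    rw [measureReal_congr (ProbabilityTheory.cond_absolutelyContinuous.ae_eq hae)] at hlim
    have hval : ν'.real S = L := by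
      rw [measureReal_def, hν', ProbabilityTheory.cond_apply hΩm, inter_eq_right.2 hSΩ, hSL,
        mul_left_comm, ENNReal.inv_mul_cancel hpos hfin, mul_one, ENNReal.toReal_ofReal hL.1.le]
    rw [hval] at hlim
    refine ge_of_tendsto' hlim fun j => ?_
    rw [measureReal_congr ((hac j).ae_eq hae), ← hJ S hSΩ j]
    refine ciInf_le ⟨0, ?_⟩ j
    rintro _ ⟨i, rfl⟩
    exact integral_nonneg fun x => sq_nonneg _
  · intro b hb
    refine le_of_forall_lt_imp_le_of_dense fun c hc => ?_
    obtain ⟨S, hS, hSc⟩ := exists_mem_jordanSets_forall_le hn hΩo hfin hpos hset hUI hL hc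
    refine (le_ciInf fun j => ?_).trans (hb ⟨S, hS, rfl⟩)
    rw [hJ S hS.1 j]
    exact hSc j
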